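/- Let $\mathcal Q_2$ be the universal unital $C^*$-algebra generated by a unitary $u$ and an isometry $s_2$ subject to the relations $s_2u=u^2s_2$ and $s_2s_2^*+us_2s_2^*u^{-1}=1$. Let $\mathrm{Ad}(s_2)$ be the endomorphism $x\mapsto s_2xs_2^*$ of $\mathcal Q_2$, let $\bar{\mathcal Q}_2$ be the $C^*$-algebraic inductive limit of the system $$\mathcal Q_2\xrightarrow{\mathrm{Ad}(s_2)}\mathcal Q_2\xrightarrow{\mathrm{Ad}(s_2)}\cdots,$$ and for $i\ge 0$ let $\iota_i:\mathcal Q_2\to\bar{\mathcal Q}_2$ be the canonical homomorphism of the $i$-th copy (counted from $0$). Let $\mathcal K(\ell^2(\mathbb N_0))$ be the $C^*$-algebra of compact operators, with matrix units $e_{k,l}$ ($k,l\in\mathbb N_0$) with respect to the standard orthonormal basis. (a) There is exactly one unital $*$-homomorphism $\vartheta_{1,2}:\mathcal Q_2\to M_2(\mathcal Q_2)$ with $$\vartheta_{1,2}(u)=\begin{pmatrix}0&u\\1&0\end{pmatrix},\qquad \vartheta_{1,2}(s_2)=\begin{pmatrix}s_2&us_2\\0&0\end{pmatrix},$$ and it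 is an isomorphism. (b) Define $\vartheta_1=\mathrm{id}_{\mathcal Q_2}$ and $\vartheta_{2^{i+1}}=(\mathrm{id}_{M_{2^i}(\mathbb C)}\otimes\vartheta_{1,2})\circ\vartheta_{2^i}$, i.e. $\vartheta_{1,2}$ is applied to every entry of a matrix in $M_{2^i}(\mathcal Q_2)$ and the resulting $2^i\times 2^i$ array of $2\times 2$ blocks is read as an element of $M_{2^{i+1}}(\mathcal Q_2)$. Then every $\vartheta_{2^i}:\mathcal Q_2\to M_{2^i}(\mathcal Q_2)$ is a $*$-isomorphism, and for all $i\ge 0$ and $x\in\mathcal Q_2$ $$\vartheta_{2^{i+1}}(s_2xs_2^*)=\begin{pmatrix}\vartheta_{2^i}(x)&0\\0&0\end{pmatrix}.$$ (c) There is exactly one $*$-isomorphism $\Phi:\bar{\mathcal Q}_2\to\mathcal K(\ell^2(\mathbb N_0))\otimes\mathcal Q_2$ such that for all $i\ge 0$ and $x\in\mathcal Q_2$ $$\Phi(\iota_i(x))=\sum_{k,l=0}^{2^i-1}e_{k,l}\otimes\vartheta_{2^i}(x)_{k,l}.$$ -/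

import Mathlib

open scoped TensorProduct ComplexConjugate
open Filter Topology
noncomputable section

/-- A C⋆-seminorm on a complex ⋆-algebra. -/
structure CStarSeminorm (F : Type*) [NonUnitalRing F] [StarRing F] [Module ℂ F] extends
    Seminorm ℂ F where
  mul_le' : ∀ x y, toFun (x * y) ≤ toFun x * toFun y
  star_mul_self' : ∀ x, toFun (star x * x) = toFun x * toFun x

namespace CStarSeminorm

section basic
variable {F : Type*} [NonUnitalRing F] [StarRing F] [Module ℂ F]

instance : CoeFun (CStarSeminorm F) (fun _ => F → ℝ) := ⟨fun p => p.toFun⟩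

theorem nonneg (p : CStarSeminorm F) (x : F) : 0 ≤ p x := apply_nonneg p.toSeminorm x

theorem le_star (p : CStarSeminorm F) (x : F) : p x ≤ p (star x) := by
  rcases (p.nonneg x).eq_or_lt with h | h
  · rw [← h]; exact p.nonneg _
  · have h1 := p.star_mul_self' x
    have h2 := p.mul_le' (star x) x
    rw [h1] at h2
    exact le_of_mul_le_mul_right h2 h

theorem star_eq (p : CStarSeminorm F) (x : F) : p (star x) = p x := by
  refine le_antisymm ?_ (p.le_star x)
  simpa using p.le_star (star x)

/-- A copy of `F`, made into a seminormed space by `p`. -/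
def Carrier (_p : CStarSeminorm F) : Type _ := F

instance (p : CStarSeminorm F) : NonUnitalRing p.Carrier := inferInstanceAs (NonUnitalRing F)
instance (p : CStarSeminorm F) : StarRing p.Carrier := inferInstanceAs (StarRing F)
instance (p : CStarSeminorm F) : Module ℂ p.Carrier := inferInstanceAs (Module ℂ F)
instance [StarModule ℂ F] (p : CStarSeminorm F) : StarModule ℂ p.Carrier :=
  inferInstanceAs (StarModule ℂ F)
instance [IsScalarTower ℂ F F] (p : CStarSeminorm F) : IsScalarTower ℂ p.Carrier p.Carrier :=
  inferInstanceAs (IsScalarTower ℂ F F)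
instance [SMulCommClass ℂ F F] (p : CStarSeminorm F) : SMulCommClass ℂ p.Carrier p.Carrier :=
  inferInstanceAs (SMulCommClass ℂ F F)

instance (p : CStarSeminorm F) : SeminormedAddCommGroup p.Carrier :=
  fast_instance% { AddGroupSeminorm.toSeminormedAddCommGroup (E := p.Carrier)
      p.toSeminorm.toAddGroupSeminorm with
    toAddCommGroup := inferInstance }

theorem norm_def (p : CStarSeminorm F) (x : p.Carrier) : ‖x‖ = p x := rfl

instance (p : CStarSeminorm F) : NonUnitalSeminormedRing p.Carrier where
  dist_eq := SeminormedAddCommGroup.dist_eq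
  norm_mul_le := p.mul_le'

instance (p : CStarSeminorm F) : NormedSpace ℂ p.Carrier where
  norm_smul_le a x := (p.toSeminorm.smul' a x).le

/-- The Hausdorff completion of `(F, p)`; it is shown below to be a C⋆-algebra. -/
def Completion (p : CStarSeminorm F) : Type _ := UniformSpace.Completion p.Carrier

instance (p : CStarSeminorm F) : NormedAddCommGroup p.Completion :=
  inferInstanceAs (NormedAddCommGroup (UniformSpace.Completion p.Carrier))
instance (p : CStarSeminorm F) : CompleteSpace p.Completion :=
  inferInstanceAs (CompleteSpace (UniformSpace.Completion p.Carrier))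
instance (p : CStarSeminorm F) : NormedSpace ℂ p.Completion :=
  inferInstanceAs (NormedSpace ℂ (UniformSpace.Completion p.Carrier))

/-- The canonical map of `F` into its completion. -/
def toCompletion (p : CStarSeminorm F) (x : F) : p.Completion :=
  UniformSpace.Completion.coe' (α := p.Carrier) x

theorem denseRange_toCompletion (p : CStarSeminorm F) : DenseRange p.toCompletion :=
  UniformSpace.Completion.denseRange_coe (α := p.Carrier)

theorem continuous_toCompletion (p : CStarSeminorm F) :
    Continuous (X := p.Carrier) (p.toCompletion) :=
  UniformSpace.Completion.continuous_coe p.Carrier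

theorem toCompletion_add (p : CStarSeminorm F) (x y : F) :
    p.toCompletion (x + y) = p.toCompletion x + p.toCompletion y :=
  UniformSpace.Completion.coe_add (α := p.Carrier) x y

theorem toCompletion_zero (p : CStarSeminorm F) : p.toCompletion 0 = 0 := rfl

theorem toCompletion_neg (p : CStarSeminorm F) (x : F) :
    p.toCompletion (-x) = -p.toCompletion x :=
  UniformSpace.Completion.coe_neg (α := p.Carrier) x

theorem toCompletion_smul (p : CStarSeminorm F) (c : ℂ) (x : F) :
    p.toCompletion (c • x) = c • p.toCompletion x :=
  UniformSpace.Completion.coe_smul (X := p.Carrier) c x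

theorem norm_toCompletion (p : CStarSeminorm F) (x : F) : ‖p.toCompletion x‖ = p x :=
  UniformSpace.Completion.norm_coe (E := p.Carrier) x

/-- An element killed by the seminorm vanishes in the completion. -/
theorem toCompletion_eq_zero (p : CStarSeminorm F) {x : F} (h : p x = 0) :
    p.toCompletion x = 0 := by
  rw [← norm_eq_zero, norm_toCompletion, h]

theorem toCompletion_sub (p : CStarSeminorm F) (x y : F) :
    p.toCompletion (x - y) = p.toCompletion x - p.toCompletion y := by
  rw [sub_eq_add_neg, toCompletion_add, toCompletion_neg, ← sub_eq_add_neg]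

@[elab_as_elim]
theorem completion_induction (p : CStarSeminorm F) {P : p.Completion → Prop} (x : p.Completion)
    (hc : IsClosed {a | P a}) (h : ∀ a : F, P (p.toCompletion a)) : P x :=
  UniformSpace.Completion.induction_on (α := p.Carrier) x hc h

section mul
variable (p : CStarSeminorm F)

/-- The multiplication of the completion: the continuous extension of that of `F`. -/
instance : Mul p.Completion :=
  ⟨fun x y => ((UniformSpace.Completion.isDenseInducing_coe (α := p.Carrier)).prodMap
    (UniformSpace.Completion.isDenseInducing_coe (α := p.Carrier))).extend
      (fun z : p.Carrier × p.Carrier => p.toCompletion (z.1 * z.2)) (x, y)⟩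

theorem toCompletion_mul (x y : F) :
    p.toCompletion (x * y) = p.toCompletion x * p.toCompletion y :=
  (((UniformSpace.Completion.isDenseInducing_coe (α := p.Carrier)).prodMap
    (UniformSpace.Completion.isDenseInducing_coe (α := p.Carrier))).extend_eq
      (f := fun z : p.Carrier × p.Carrier => p.toCompletion (z.1 * z.2))
      (p.continuous_toCompletion.comp (continuous_mul (M := p.Carrier))) (x, y)).symm

instance : ContinuousMul p.Completion where
  continuous_mul := by
    let m := (AddMonoidHom.mul : p.Carrier →+ p.Carrier →+ p.Carrier).compr₂
      (UniformSpace.Completion.toCompl (α := p.Carrier))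
    have h : Continuous fun z : p.Carrier × p.Carrier => m z.1 z.2 :=
      p.continuous_toCompletion.comp (continuous_mul (M := p.Carrier))
    have di : IsDenseInducing (UniformSpace.Completion.toCompl : p.Carrier → _) :=
      UniformSpace.Completion.isDenseInducing_coe
    exact (di.extend_Z_bilin di h :)

theorem completion_mul_assoc (a b c : p.Completion) : a * b * c = a * (b * c) := by
  refine p.completion_induction a (isClosed_eq
    ((continuous_id.mul continuous_const).mul continuous_const)
    (continuous_id.mul continuous_const)) fun x => ?_
  refine p.completion_induction b (isClosed_eq
    ((continuous_const.mul continuous_id).mul continuous_const)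
    (continuous_const.mul (continuous_id.mul continuous_const))) fun y => ?_
  refine p.completion_induction c (isClosed_eq
    (continuous_const.mul continuous_id)
    (continuous_const.mul (continuous_const.mul continuous_id))) fun z => ?_
  simp only [← toCompletion_mul, mul_assoc]

theorem completion_mul_add (a b c : p.Completion) : a * (b + c) = a * b + a * c := by
  refine p.completion_induction a (isClosed_eq (by fun_prop) (by fun_prop)) fun x => ?_
  refine p.completion_induction b (isClosed_eq (by fun_prop) (by fun_prop)) fun y => ?_
  refine p.completion_induction c (isClosed_eq (by fun_prop) (by fun_prop)) fun z => ?_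
  simp only [← toCompletion_mul, ← toCompletion_add, mul_add]

theorem completion_add_mul (a b c : p.Completion) : (a + b) * c = a * c + b * c := by
  refine p.completion_induction a (isClosed_eq (by fun_prop) (by fun_prop)) fun x => ?_
  refine p.completion_induction b (isClosed_eq (by fun_prop) (by fun_prop)) fun y => ?_
  refine p.completion_induction c (isClosed_eq (by fun_prop) (by fun_prop)) fun z => ?_
  simp only [← toCompletion_mul, ← toCompletion_add, add_mul]

theorem completion_zero_mul (a : p.Completion) : 0 * a = 0 := by
  refine p.completion_induction a (isClosed_eq (by fun_prop) (by fun_prop)) fun x => ?_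
  rw [← toCompletion_zero, ← toCompletion_mul, zero_mul]

theorem completion_mul_zero (a : p.Completion) : a * 0 = 0 := by
  refine p.completion_induction a (isClosed_eq (by fun_prop) (by fun_prop)) fun x => ?_
  rw [← toCompletion_zero, ← toCompletion_mul, mul_zero]

instance : NonUnitalRing p.Completion where
  zero_mul := p.completion_zero_mul
  mul_zero := p.completion_mul_zero
  mul_assoc := p.completion_mul_assoc
  left_distrib := p.completion_mul_add
  right_distrib := p.completion_add_mul

instance : NonUnitalNormedRing p.Completion where
  dist_eq := NormedAddCommGroup.dist_eq
  norm_mul_le := fun a b =>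
    p.completion_induction a (isClosed_le (by fun_prop) (by fun_prop)) fun a =>
    p.completion_induction b (isClosed_le (by fun_prop) (by fun_prop)) fun b => by
      simpa only [← toCompletion_mul, norm_toCompletion] using p.mul_le' a b

/-- The involution of the completion: the continuous extension of that of `F`. -/
instance : Star p.Completion :=
  ⟨UniformSpace.Completion.map (α := p.Carrier) (β := p.Carrier) star⟩

theorem uniformContinuous_star_carrier :
    UniformContinuous (star : p.Carrier → p.Carrier) := by
  refine (AddMonoidHomClass.isometry_of_norm (starAddEquiv : p.Carrier ≃+ p.Carrier) ?_
    ).uniformContinuous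
  exact fun x => p.star_eq x

theorem toCompletion_star (x : F) : p.toCompletion (star x) = star (p.toCompletion x) :=
  (UniformSpace.Completion.map_coe p.uniformContinuous_star_carrier x).symm

instance : ContinuousStar p.Completion :=
  ⟨UniformSpace.Completion.continuous_map⟩

theorem completion_star_mul (a b : p.Completion) : star (a * b) = star b * star a := by
  refine p.completion_induction a (isClosed_eq (by fun_prop) (by fun_prop)) fun x => ?_
  refine p.completion_induction b (isClosed_eq (by fun_prop) (by fun_prop)) fun y => ?_
  simp only [← toCompletion_star, ← toCompletion_mul, star_mul]

theorem completion_star_add (a b : p.Completion) : star (a + b) = star a + star b := by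
  refine p.completion_induction a (isClosed_eq (by fun_prop) (by fun_prop)) fun x => ?_
  refine p.completion_induction b (isClosed_eq (by fun_prop) (by fun_prop)) fun y => ?_
  simp only [← toCompletion_star, ← toCompletion_add, star_add]

theorem completion_star_star (a : p.Completion) : star (star a) = a := by
  refine p.completion_induction a (isClosed_eq (by fun_prop) (by fun_prop)) fun x => ?_
  simp only [← toCompletion_star, star_star]

instance : StarRing p.Completion where
  star_involutive := p.completion_star_star
  star_mul := p.completion_star_mul
  star_add := p.completion_star_add

theorem completion_norm_mul_self_le (a : p.Completion) : ‖a‖ * ‖a‖ ≤ ‖star a * a‖ := by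
  refine p.completion_induction a (isClosed_le (by fun_prop) (by fun_prop)) fun x => ?_
  simpa only [← toCompletion_star, ← toCompletion_mul, norm_toCompletion] using
    (p.star_mul_self' x).ge

theorem completion_smul_mul [IsScalarTower ℂ F F] (c : ℂ) (a b : p.Completion) :
    (c • a) * b = c • (a * b) := by
  have hc : Continuous fun z : p.Completion => c • z := continuous_const_smul c
  refine p.completion_induction a (isClosed_eq (hc.mul continuous_const)
    (hc.comp (continuous_id.mul continuous_const))) fun x => ?_
  refine p.completion_induction b (isClosed_eq (continuous_const.mul continuous_id)
    (hc.comp (continuous_const.mul continuous_id))) fun y => ?_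
  rw [← toCompletion_smul, ← toCompletion_mul, ← toCompletion_mul, ← toCompletion_smul,
    smul_mul_assoc]

theorem completion_mul_smul [SMulCommClass ℂ F F] (c : ℂ) (a b : p.Completion) :
    a * (c • b) = c • (a * b) := by
  have hc : Continuous fun z : p.Completion => c • z := continuous_const_smul c
  refine p.completion_induction a (isClosed_eq (continuous_id.mul continuous_const)
    (hc.comp (continuous_id.mul continuous_const))) fun x => ?_
  refine p.completion_induction b (isClosed_eq (continuous_const.mul hc)
    (hc.comp (continuous_const.mul continuous_id))) fun y => ?_
  rw [← toCompletion_smul, ← toCompletion_mul, ← toCompletion_mul, ← toCompletion_smul,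
    mul_smul_comm]

theorem completion_star_smul [StarModule ℂ F] (c : ℂ) (a : p.Completion) :
    star (c • a) = star c • star a := by
  have hc : ∀ c : ℂ, Continuous fun z : p.Completion => c • z := fun c => continuous_const_smul c
  refine p.completion_induction a (isClosed_eq (continuous_star.comp (hc c))
    ((hc (star c)).comp continuous_star)) fun x => ?_
  rw [← toCompletion_star, ← toCompletion_smul, ← toCompletion_smul, ← toCompletion_star,
    star_smul]

/-- The completion of a ⋆-algebra in a C⋆-seminorm is a C⋆-algebra. -/
instance [StarModule ℂ F] [IsScalarTower ℂ F F] [SMulCommClass ℂ F F] :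
    NonUnitalCStarAlgebra p.Completion where
  norm_mul_self_le := p.completion_norm_mul_self_le
  smul_assoc := p.completion_smul_mul
  smul_comm := fun c a b => (p.completion_mul_smul c a b).symm
  star_smul := p.completion_star_smul

end mul

/-- The pointwise supremum of a family of C⋆-seminorms that is bounded at every element. -/
def sup (S : Set (CStarSeminorm F)) (hne : S.Nonempty)
    (hS : ∀ x : F, ∃ C : ℝ, ∀ p ∈ S, p x ≤ C) : CStarSeminorm F :=
  have : Nonempty S := hne.to_subtype
  have bdd : ∀ x : F, BddAbove (Set.range fun p : S => p.1 x) := fun x => by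
    obtain ⟨C, hC⟩ := hS x
    exact ⟨C, by rintro _ ⟨p, rfl⟩; exact hC p.1 p.2⟩
  have le : ∀ (p : S) (x : F), p.1 x ≤ ⨆ p : S, p.1 x := fun p x => le_ciSup (bdd x) p
  have nn : ∀ x : F, 0 ≤ ⨆ p : S, p.1 x := fun x => Real.iSup_nonneg fun p => p.1.nonneg x
  { toFun := fun x => ⨆ p : S, p.1 x
    map_zero' := by
      have : ∀ p : S, p.1 (0 : F) = 0 := fun p => map_zero p.1.toSeminorm
      simp [this]
    add_le' := fun x y => ciSup_le fun p =>
      (map_add_le_add p.1.toSeminorm x y).trans (add_le_add (le p x) (le p y))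
    neg' := fun x => by
      have : ∀ p : S, p.1 (-x) = p.1 x := fun p => map_neg_eq_map p.1.toSeminorm x
      simp [this]
    smul' := fun c x => by
      have : ∀ p : S, p.1 (c • x) = ‖c‖ * p.1 x := fun p => p.1.toSeminorm.smul' c x
      simp [this, Real.mul_iSup_of_nonneg]
    mul_le' := fun x y => ciSup_le fun p =>
      (p.1.mul_le' x y).trans (mul_le_mul (le p x) (le p y) (p.1.nonneg y) (nn x))
    star_mul_self' := fun x => by
      refine le_antisymm (ciSup_le fun p => ?_) ?_
      · rw [p.1.star_mul_self']
        exact mul_le_mul (le p x) (le p x) (p.1.nonneg x) (nn x)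
      · set M := ⨆ p : S, p.1 (star x * x) with hM
        have h0 : 0 ≤ M := nn _
        have h : ∀ p : S, p.1 x ≤ √M := fun p => by
          refine Real.le_sqrt_of_sq_le ?_
          rw [sq, ← p.1.star_mul_self']
          exact le p _
        have h1 : (⨆ p : S, p.1 x) ≤ √M := ciSup_le h
        calc _ ≤ √M * √M := mul_le_mul h1 h1 (nn x) (Real.sqrt_nonneg _)
          _ = M := Real.mul_self_sqrt h0 }

end basic

end CStarSeminorm

/-! ### Completions of unital ⋆-algebras -/

namespace CStarSeminorm
variable {F : Type*} [Ring F] [StarRing F] [Algebra ℂ F] (p : CStarSeminorm F)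

instance : One p.Completion := ⟨p.toCompletion 1⟩

theorem toCompletion_one : p.toCompletion 1 = 1 := rfl

theorem completion_one_mul (a : p.Completion) : 1 * a = a := by
  refine p.completion_induction a (isClosed_eq (continuous_const.mul continuous_id)
    continuous_id) fun x => ?_
  rw [← toCompletion_one, ← toCompletion_mul, one_mul]

theorem completion_mul_one (a : p.Completion) : a * 1 = a := by
  refine p.completion_induction a (isClosed_eq (continuous_id.mul continuous_const)
    continuous_id) fun x => ?_
  rw [← toCompletion_one, ← toCompletion_mul, mul_one]

/-- The completion of a unital ⋆-algebra in a C⋆-seminorm is a unital C⋆-algebra. -/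
@[reducible] def completionCStarAlgebra [StarModule ℂ F] : CStarAlgebra p.Completion :=
  letI : NormedRing p.Completion :=
    { (inferInstance : NonUnitalNormedRing p.Completion) with
      one := 1
      one_mul := p.completion_one_mul
      mul_one := p.completion_mul_one }
  { (inferInstance : NormedRing p.Completion),
    (inferInstance : NonUnitalCStarAlgebra p.Completion) with
    algebraMap :=
      { toFun := fun c => c • (1 : p.Completion)
        map_one' := one_smul ℂ _
        map_zero' := zero_smul ℂ _
        map_add' := fun c d => add_smul c d _
        map_mul' := fun c d => by
          rw [completion_smul_mul, completion_one_mul, mul_smul] }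
    commutes' := fun c x => by
      change (c • (1 : p.Completion)) * x = x * (c • (1 : p.Completion))
      rw [completion_smul_mul, completion_one_mul, completion_mul_smul, completion_mul_one]
    smul_def' := fun c x => by
      change c • x = (c • (1 : p.Completion)) * x
      rw [completion_smul_mul, completion_one_mul]
    norm_smul_le := fun c x => (norm_smul c x).le }

end CStarSeminorm

/-! ### The free unital ⋆-algebra on two generators -/

/-- Names of the generators. -/
inductive Gen
  | u
  | s

/-- The free unital complex ⋆-algebra on two generators: it has as a basis the words in the four
letters `u, u⋆, s, s⋆`, the letter `(g, true)` standing for the adjoint of the letter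
`(g, false)`. -/
abbrev FreeStarAlg : Type := MonoidAlgebra ℂ (FreeMonoid (Gen × Bool))

namespace FreeStarAlg

/-- The basis element given by a word. -/
def word (w : FreeMonoid (Gen × Bool)) : FreeStarAlg := MonoidAlgebra.of ℂ _ w

theorem word_mul (v w : FreeMonoid (Gen × Bool)) : word (v * w) = word v * word w :=
  map_mul (MonoidAlgebra.of ℂ _) v w

theorem word_one : word 1 = 1 := rfl

/-- The adjoint of a word: reverse it and exchange every letter with its adjoint. -/
def starWord (w : FreeMonoid (Gen × Bool)) : FreeMonoid (Gen × Bool) :=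
  FreeMonoid.map (fun l : Gen × Bool => (l.1, !l.2)) (star w)

theorem starWord_mul (v w : FreeMonoid (Gen × Bool)) :
    starWord (v * w) = starWord w * starWord v := by
  simp [starWord]

theorem starWord_starWord (w : FreeMonoid (Gen × Bool)) : starWord (starWord w) = w := by
  induction w using FreeMonoid.inductionOn' with
  | one => rfl
  | of_mul x w ih =>
    rw [starWord_mul, starWord_mul, ih]
    simp [starWord]

@[elab_as_elim]
theorem induction {P : FreeStarAlg → Prop} (x : FreeStarAlg)
    (hw : ∀ (c : ℂ) w, P (c • word w)) (hadd : ∀ x y, P x → P y → P (x + y)) : P x := by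
  refine MonoidAlgebra.induction_linear (motive := P) x ?_ hadd ?_
  · simpa using hw 0 1
  · intro w c
    simpa [word] using hw c w

/-- The conjugate-linear involution with `star (word w) = word (starWord w)`. -/
def starFun : FreeStarAlg →+ FreeStarAlg :=
  (Finsupp.liftAddHom fun w : FreeMonoid (Gen × Bool) =>
    ({ toFun := fun c => conj c • word (starWord w)
       map_zero' := by simp
       map_add' := fun c d => by simp [add_smul] } : ℂ →+ FreeStarAlg)).comp
    (MonoidAlgebra.coeffAddEquiv : FreeStarAlg ≃+ _).toAddMonoidHom

theorem starFun_smul_word (c : ℂ) (w : FreeMonoid (Gen × Bool)) :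
    starFun (c • word w) = conj c • word (starWord w) := by
  simp [starFun, word]

theorem starFun_mul (x y : FreeStarAlg) : starFun (x * y) = starFun y * starFun x := by
  induction x using FreeStarAlg.induction with
  | hadd x₁ x₂ h₁ h₂ => rw [add_mul, map_add, h₁, h₂, map_add, mul_add]
  | hw c v =>
    induction y using FreeStarAlg.induction with
    | hadd y₁ y₂ h₁ h₂ => rw [mul_add, map_add, h₁, h₂, map_add, add_mul]
    | hw d w =>
      rw [smul_mul_smul_comm, ← word_mul, starFun_smul_word, starFun_smul_word, starFun_smul_word,
        smul_mul_smul_comm, ← word_mul, starWord_mul, map_mul, mul_comm (conj c)]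

theorem starFun_starFun (x : FreeStarAlg) : starFun (starFun x) = x := by
  induction x using FreeStarAlg.induction with
  | hadd x₁ x₂ h₁ h₂ => rw [map_add, map_add, h₁, h₂]
  | hw c v => rw [starFun_smul_word, starFun_smul_word, starWord_starWord, Complex.conj_conj]

instance : StarRing FreeStarAlg where
  star := starFun
  star_involutive := starFun_starFun
  star_mul := starFun_mul
  star_add := map_add starFun

theorem star_smul_word (c : ℂ) (w : FreeMonoid (Gen × Bool)) :
    star (c • word w) = conj c • word (starWord w) := starFun_smul_word c w

instance : StarModule ℂ FreeStarAlg where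
  star_smul c x := by
    induction x using FreeStarAlg.induction with
    | hadd x₁ x₂ h₁ h₂ => rw [smul_add, star_add, h₁, h₂, star_add, smul_add]
    | hw d w => rw [smul_smul, star_smul_word, star_smul_word, smul_smul, map_mul]; rfl

/-- The generators of the free ⋆-algebra. -/
def gen (g : Gen) : FreeStarAlg := word (FreeMonoid.of (g, false))

theorem star_gen (g : Gen) : star (gen g) = word (FreeMonoid.of (g, true)) := by
  have := star_smul_word 1 (FreeMonoid.of (g, false))
  simpa [gen, starWord] using this

end FreeStarAlg

/-! ### The universal C⋆-algebra `𝒬₂` -/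

/-- Two elements `u`, `s` of a unital ⋆-algebra satisfy the defining relations of `𝒬₂`: `u` is
unitary, `s` is an isometry, `s u = u² s` and `s s⋆ + u s s⋆ u⁻¹ = 1` (where `u⁻¹ = u⋆`). -/
structure Q2Relations {A : Type*} [Ring A] [StarRing A] (u s : A) : Prop where
  star_mul_u : star u * u = 1
  u_mul_star : u * star u = 1
  star_mul_s : star s * s = 1
  s_mul_u : s * u = u ^ 2 * s
  range_sum : s * star s + u * (s * star s) * star u = 1

namespace Q2Alg

/-- The C⋆-seminorms on the free ⋆-algebra with respect to which the defining relations of `𝒬₂`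
hold for the two generators. -/
def admissible : Set (CStarSeminorm FreeStarAlg) :=
  {p | letI u := FreeStarAlg.gen .u
       letI s := FreeStarAlg.gen .s
       p (star u * u - 1) = 0 ∧ p (u * star u - 1) = 0 ∧ p (star s * s - 1) = 0 ∧
       p (s * u - u ^ 2 * s) = 0 ∧ p (s * star s + u * (s * star s) * star u - 1) = 0}

theorem admissible_nonempty : admissible.Nonempty :=
  ⟨{ (0 : Seminorm ℂ FreeStarAlg) with
      mul_le' := fun x y => by
        change (0 : ℝ) ≤ 0 * 0
        simp
      star_mul_self' := fun x => by
        change (0 : ℝ) = 0 * 0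
        simp }, rfl, rfl, rfl, rfl, rfl⟩

theorem admissible_one_le {p : CStarSeminorm FreeStarAlg} : p 1 ≤ 1 := by
  have h := p.star_mul_self' 1
  rw [star_one, mul_one] at h
  nlinarith [p.nonneg 1]

theorem le_one_of_isometry {p : CStarSeminorm FreeStarAlg} {x : FreeStarAlg}
    (h : p (star x * x - 1) = 0) : p x ≤ 1 := by
  have h1 := p.star_mul_self' x
  have h2 : p (star x * x - 1 + 1) ≤ p (star x * x - 1) + p 1 :=
    map_add_le_add p.toSeminorm (star x * x - 1) 1
  rw [sub_add_cancel] at h2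
  nlinarith [p.nonneg x, admissible_one_le (p := p)]

theorem word_le_one {p : CStarSeminorm FreeStarAlg} (hp : p ∈ admissible)
    (w : FreeMonoid (Gen × Bool)) : p (FreeStarAlg.word w) ≤ 1 := by
  obtain ⟨h1, -, h3, -, -⟩ := hp
  have hg : ∀ g, p (FreeStarAlg.gen g) ≤ 1 := by
    rintro (_ | _)
    · exact le_one_of_isometry h1
    · exact le_one_of_isometry h3
  induction w using FreeMonoid.inductionOn' with
  | one => exact admissible_one_le
  | of_mul x w ih =>
    rw [FreeStarAlg.word_mul]
    have hx : p (FreeStarAlg.word (FreeMonoid.of x)) ≤ 1 := by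
      obtain ⟨g, _ | _⟩ := x
      · exact hg g
      · rw [← FreeStarAlg.star_gen, p.star_eq]
        exact hg g
    exact (p.mul_le' _ _).trans (mul_le_one₀ hx (p.nonneg _) ih)

theorem admissible_bdd (x : FreeStarAlg) : ∃ C : ℝ, ∀ p ∈ admissible, p x ≤ C := by
  induction x using FreeStarAlg.induction with
  | hadd x y hx hy =>
    obtain ⟨C, hC⟩ := hx
    obtain ⟨D, hD⟩ := hy
    exact ⟨C + D, fun p hp =>
      (map_add_le_add p.toSeminorm x y).trans (add_le_add (hC p hp) (hD p hp))⟩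
  | hw c w =>
    refine ⟨‖c‖, fun p hp => ?_⟩
    have h : p (c • FreeStarAlg.word w) = ‖c‖ * p (FreeStarAlg.word w) := p.toSeminorm.smul' c _
    rw [h]
    exact mul_le_of_le_one_right (norm_nonneg c) (word_le_one hp w)

/-- The largest C⋆-seminorm on the free ⋆-algebra for which the relations hold. -/
def univSeminorm : CStarSeminorm FreeStarAlg :=
  CStarSeminorm.sup admissible admissible_nonempty admissible_bdd

end Q2Alg

/-- `𝒬₂`: the universal unital C⋆-algebra generated by a unitary `u` and an isometry `s₂` with
`s₂ u = u² s₂` and `s₂ s₂⋆ + u s₂ s₂⋆ u⁻¹ = 1`, that is, the completion of the free unital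
⋆-algebra on two generators in the largest C⋆-seminorm for which the relations hold. -/
def Q2Alg : Type := Q2Alg.univSeminorm.Completion

namespace Q2Alg

instance : CStarAlgebra Q2Alg := univSeminorm.completionCStarAlgebra

/-- The canonical unitary generator of `𝒬₂`. -/
def u : Q2Alg := univSeminorm.toCompletion (FreeStarAlg.gen .u)

/-- The canonical isometric generator `s₂` of `𝒬₂`. -/
def s : Q2Alg := univSeminorm.toCompletion (FreeStarAlg.gen .s)

theorem univSeminorm_admissible : univSeminorm ∈ admissible := by
  have h : ∀ x, (∀ p ∈ admissible, p x = 0) → univSeminorm x = 0 := fun x hx => by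
    change (⨆ p : admissible, p.1 x) = 0
    simp [fun p : admissible => hx p.1 p.2]
  exact ⟨h _ fun p hp => hp.1, h _ fun p hp => hp.2.1, h _ fun p hp => hp.2.2.1,
    h _ fun p hp => hp.2.2.2.1, h _ fun p hp => hp.2.2.2.2⟩

theorem relations : Q2Relations u s := by
  have key : ∀ {x y : FreeStarAlg}, univSeminorm (x - y) = 0 →
      univSeminorm.toCompletion x = univSeminorm.toCompletion y := fun {x y} h => by
    rw [← sub_eq_zero, ← CStarSeminorm.toCompletion_sub, CStarSeminorm.toCompletion_eq_zero _ h]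
  obtain ⟨h1, h2, h3, h4, h5⟩ := univSeminorm_admissible
  have m := univSeminorm.toCompletion_mul
  have st := univSeminorm.toCompletion_star
  have ad := univSeminorm.toCompletion_add
  refine ⟨?_, ?_, ?_, ?_, ?_⟩
  · have := key h1
    rw [m, st] at this; exact this
  · have := key h2
    rw [m, st] at this; exact this
  · have := key h3
    rw [m, st] at this; exact this
  · have := key h4
    rw [pow_two, m, m, m] at this
    rw [pow_two]; exact this
  · have := key h5
    rw [ad, m, m, m, m, st, st] at this; exact this

end Q2Alg


/-! ### The universal property of `𝒬₂` -/

namespace CStarSeminorm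

/-- A ⋆-homomorphism into a C⋆-algebra dominated by `p` extends to the completion. -/
theorem exists_extension {F : Type*} [NonUnitalRing F] [StarRing F] [Module ℂ F]
    (p : CStarSeminorm F) {B : Type*} [NonUnitalCStarAlgebra B] (f : F →⋆ₙₐ[ℂ] B)
    (hf : ∀ x, ‖f x‖ ≤ p x) :
    ∃ g : p.Completion →⋆ₙₐ[ℂ] B, Continuous g ∧ ∀ x, g (p.toCompletion x) = f x := by
  let f₀ : p.Carrier →+ B := AddMonoidHomClass.toAddMonoidHom f
  have hu : UniformContinuous f₀ :=
    (AddMonoidHomClass.lipschitz_of_bound f₀ 1 fun x => by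
      rw [one_mul]; exact hf x).uniformContinuous
  let g₀ : p.Completion → B := UniformSpace.Completion.extension f₀
  have hg : Continuous g₀ := UniformSpace.Completion.continuous_extension
  have hgf : ∀ x, g₀ (p.toCompletion x) = f x :=
    fun x => UniformSpace.Completion.extension_coe (α := p.Carrier) hu x
  refine ⟨{ toFun := g₀, map_smul' := ?_, map_zero' := ?_, map_add' := ?_, map_mul' := ?_,
            map_star' := ?_ }, hg, hgf⟩
  · intro c x
    refine p.completion_induction x (isClosed_eq (hg.comp (continuous_const_smul c))
      ((continuous_const_smul c).comp hg)) fun x => ?_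
    rw [← toCompletion_smul, hgf, hgf, map_smul]; rfl
  · rw [← toCompletion_zero, hgf, map_zero]
  · intro x y
    refine p.completion_induction x (isClosed_eq (hg.comp (continuous_id.add continuous_const))
      (hg.add continuous_const)) fun x => ?_
    refine p.completion_induction y (isClosed_eq (hg.comp (continuous_const.add continuous_id))
      (continuous_const.add hg)) fun y => ?_
    rw [← toCompletion_add, hgf, hgf, hgf, map_add]
  · intro x y
    refine p.completion_induction x (isClosed_eq (hg.comp (continuous_id.mul continuous_const))
      (hg.mul continuous_const)) fun x => ?_
    refine p.completion_induction y (isClosed_eq (hg.comp (continuous_const.mul continuous_id))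
      (continuous_const.mul hg)) fun y => ?_
    rw [← toCompletion_mul, hgf, hgf, hgf, map_mul]
  · intro x
    refine p.completion_induction x (isClosed_eq (hg.comp continuous_star)
      (continuous_star.comp hg)) fun x => ?_
    rw [← toCompletion_star, hgf, hgf, map_star]

end CStarSeminorm

namespace Q2Alg

/-- The evaluation of the free ⋆-algebra at a pair of elements of a C⋆-algebra. -/
theorem exists_eval {B : Type*} [CStarAlgebra B] (U S : B) :
    ∃ f : FreeStarAlg →⋆ₐ[ℂ] B, f (.gen .u) = U ∧ f (.gen .s) = S := by
  let e : Gen → B := fun g => match g with | .u => U | .s => S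
  let w : FreeMonoid (Gen × Bool) →* B :=
    FreeMonoid.lift fun l => if l.2 then star (e l.1) else e l.1
  let f : FreeStarAlg →ₐ[ℂ] B := MonoidAlgebra.lift ℂ B (FreeMonoid (Gen × Bool)) w
  have hfw : ∀ v, f (FreeStarAlg.word v) = w v := fun v => MonoidAlgebra.lift_of _ v
  have hw : ∀ v, w (FreeStarAlg.starWord v) = star (w v) := fun v => by
    induction v using FreeMonoid.inductionOn' with
    | one => simp [FreeStarAlg.starWord]
    | of_mul x v ih =>
      rw [FreeStarAlg.starWord_mul, map_mul, ih, map_mul, star_mul]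
      congr 1
      obtain ⟨g, _ | _⟩ := x <;> simp [FreeStarAlg.starWord, w]
  refine ⟨{ f with map_star' := fun x => ?_ }, ?_, ?_⟩
  · change f (star x) = star (f x)
    induction x using FreeStarAlg.induction with
    | hadd x₁ x₂ h₁ h₂ => rw [star_add, map_add, h₁, h₂, map_add, star_add]
    | hw c v =>
      rw [FreeStarAlg.star_smul_word, map_smul, map_smul, hfw, hfw, hw, star_smul]; rfl
  · exact (hfw _).trans (by simp [w, e])
  · exact (hfw _).trans (by simp [w, e])

/-- The universal property of `𝒬₂`: every pair in a unital C⋆-algebra that satisfies the relations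
is the image of `(u, s₂)` under exactly one unital ⋆-homomorphism. -/
theorem existsUnique_hom {B : Type*} [CStarAlgebra B] (U S : B) (h : Q2Relations U S) :
    ∃! φ : Q2Alg →⋆ₐ[ℂ] B, φ u = U ∧ φ s = S := by
  obtain ⟨f, rfl, rfl⟩ := exists_eval U S
  let q : CStarSeminorm FreeStarAlg :=
    { (normSeminorm ℂ B).comp f.toAlgHom.toLinearMap with
      mul_le' := fun x y => by
        change ‖f (x * y)‖ ≤ ‖f x‖ * ‖f y‖
        rw [map_mul]; exact norm_mul_le _ _
      star_mul_self' := fun x => by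
        change ‖f (star x * x)‖ = ‖f x‖ * ‖f x‖
        rw [map_mul, map_star]; exact CStarRing.norm_star_mul_self }
  have hq : ∀ x, q x = ‖f x‖ := fun x => rfl
  have hqa : q ∈ admissible := by
    have hs : ∀ x, f (star x) = star (f x) := map_star f
    refine ⟨?_, ?_, ?_, ?_, ?_⟩ <;> rw [hq, norm_eq_zero, map_sub, sub_eq_zero]
    · simpa [hs] using h.star_mul_u
    · simpa [hs] using h.u_mul_star
    · simpa [hs] using h.star_mul_s
    · simpa using h.s_mul_u
    · simpa [hs] using h.range_sum
  have hfu : ∀ x, ‖f x‖ ≤ univSeminorm x := fun x => by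
    obtain ⟨C, hC⟩ := admissible_bdd x
    exact le_ciSup (f := fun p : admissible => p.1 x)
      ⟨C, by rintro _ ⟨p, rfl⟩; exact hC p.1 p.2⟩ ⟨q, hqa⟩
  obtain ⟨g, hg, hgf⟩ := univSeminorm.exists_extension (f : FreeStarAlg →⋆ₙₐ[ℂ] B) hfu
  let φ : Q2Alg →⋆ₐ[ℂ] B :=
    { toFun := g
      map_one' := (hgf 1).trans (map_one f)
      map_mul' := map_mul g
      map_zero' := map_zero g
      map_add' := map_add g
      commutes' := fun c => by
        rw [Algebra.algebraMap_eq_smul_one, Algebra.algebraMap_eq_smul_one]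
        exact (map_smul g c (1 : univSeminorm.Completion)).trans
          (congrArg (c • ·) ((hgf 1).trans (map_one f)))
      map_star' := map_star g }
  refine ⟨φ, ⟨hgf _, hgf _⟩, fun ψ hψ => ?_⟩
  have hψc : Continuous ψ := (AddMonoidHomClass.lipschitz_of_bound ψ 1 fun x => by
    rw [one_mul]; exact NonUnitalStarAlgHom.norm_apply_le ψ x).continuous
  refine StarAlgHom.ext fun x => ?_
  refine univSeminorm.completion_induction x (isClosed_eq hψc hg) fun x => ?_
  refine Eq.trans ?_ (hgf x).symm
  induction x using FreeStarAlg.induction with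
  | hadd x y hx hy =>
    rw [CStarSeminorm.toCompletion_add]
    exact (map_add ψ _ _).trans ((congrArg₂ _ hx hy).trans (map_add f x y).symm)
  | hw c w =>
    rw [CStarSeminorm.toCompletion_smul]
    refine (map_smul ψ c (univSeminorm.toCompletion (FreeStarAlg.word w) : Q2Alg)).trans
      (Eq.trans (congrArg (c • ·) ?_) (map_smul f c _).symm)
    induction w using FreeMonoid.inductionOn' with
    | one => exact (map_one ψ).trans (map_one f).symm
    | of_mul l w ih =>
      rw [FreeStarAlg.word_mul, CStarSeminorm.toCompletion_mul]
      refine (map_mul ψ _ _).trans (Eq.trans (congrArg₂ _ ?_ ih) (map_mul f _ _).symm)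
      have hgen : ∀ i, ψ (univSeminorm.toCompletion (FreeStarAlg.gen i)) = f (.gen i) := by
        rintro (_ | _)
        exacts [hψ.1, hψ.2]
      obtain ⟨i, _ | _⟩ := l
      · exact hgen i
      · rw [← FreeStarAlg.star_gen, CStarSeminorm.toCompletion_star]
        exact (map_star ψ _).trans ((congrArg star (hgen i)).trans (map_star f _).symm)

end Q2Alg

/-- The endomorphism `Ad(s₂) : x ↦ s₂ x s₂⋆` of `𝒬₂`. -/
def Q2Alg.Ad : Q2Alg →⋆ₙₐ[ℂ] Q2Alg where
  toFun x := s * x * star s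
  map_smul' c x := by simp
  map_zero' := by simp
  map_add' x y := by rw [mul_add, add_mul]
  map_mul' x y := by
    have h : ∀ z : Q2Alg, star s * (s * z) = z := fun z => by
      rw [← mul_assoc, relations.star_mul_s, one_mul]
    simp only [mul_assoc, h]
  map_star' x := by simp [mul_assoc]

/-! ### The inductive limit of a stationary system -/

namespace StationaryLimit
variable {A : Type*} [NonUnitalCStarAlgebra A] (φ : A →⋆ₙₐ[ℂ] A)

/-- The ⋆-algebra of those sequences in `A` that are eventually compatible with the connecting
maps of the direct system `A → A → A → ⋯` all of whose connecting maps are `φ`. -/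
def Threads : NonUnitalStarSubalgebra ℂ (ℕ → A) where
  carrier := {x | ∀ᶠ n in atTop, x (n + 1) = φ (x n)}
  add_mem' {x y} hx hy := by
    filter_upwards [hx, hy] with n h₁ h₂
    simp [h₁, h₂]
  zero_mem' := by simp
  mul_mem' {x y} hx hy := by
    filter_upwards [hx, hy] with n h₁ h₂
    simp [h₁, h₂]
  smul_mem' c x hx := by
    filter_upwards [hx] with n h₁
    simp [h₁]
  star_mem' {x} hx := by
    filter_upwards [hx] with n h₁
    simp [h₁, map_star]

theorem exists_tendsto_norm (x : Threads φ) :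
    ∃ r : ℝ, Tendsto (fun n => ‖x.1 n‖) atTop (𝓝 r) := by
  obtain ⟨N, hN⟩ := eventually_atTop.1 x.2
  have hanti : Antitone fun n => ‖x.1 (n + N)‖ := by
    refine antitone_nat_of_succ_le fun n => ?_
    have h : x.1 (n + 1 + N) = φ (x.1 (n + N)) := by
      rw [add_right_comm]; exact hN (n + N) (by omega)
    rw [h]
    exact NonUnitalStarAlgHom.norm_apply_le φ _
  exact ⟨_, (tendsto_add_atTop_iff_nat N).1 (tendsto_atTop_ciInf hanti
    ⟨0, by rintro _ ⟨n, rfl⟩; exact norm_nonneg _⟩)⟩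

/-- The limit of the norms of a thread. -/
def limNorm (x : Threads φ) : ℝ := limUnder atTop fun n => ‖x.1 n‖

theorem tendsto_limNorm (x : Threads φ) :
    Tendsto (fun n => ‖x.1 n‖) atTop (𝓝 (limNorm φ x)) :=
  tendsto_nhds_limUnder (exists_tendsto_norm φ x)

/-- The C⋆-seminorm `x ↦ lim ‖x n‖` on the algebra of threads. -/
def seminorm : CStarSeminorm (Threads φ) where
  toFun := limNorm φ
  map_zero' := tendsto_nhds_unique (tendsto_limNorm φ 0) (by simp)
  add_le' x y := le_of_tendsto_of_tendsto' (tendsto_limNorm φ (x + y))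
    ((tendsto_limNorm φ x).add (tendsto_limNorm φ y)) fun n => norm_add_le _ _
  neg' x := tendsto_nhds_unique (tendsto_limNorm φ (-x)) (by simpa using tendsto_limNorm φ x)
  smul' c x := tendsto_nhds_unique (tendsto_limNorm φ (c • x))
    (by simpa [norm_smul] using (tendsto_limNorm φ x).const_mul ‖c‖)
  mul_le' x y := le_of_tendsto_of_tendsto' (tendsto_limNorm φ (x * y))
    ((tendsto_limNorm φ x).mul (tendsto_limNorm φ y)) fun n => norm_mul_le _ _
  star_mul_self' x := tendsto_nhds_unique (tendsto_limNorm φ (star x * x))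
    (((tendsto_limNorm φ x).mul (tendsto_limNorm φ x)).congr fun n =>
      (CStarRing.norm_star_mul_self (x := x.1 n)).symm)

end StationaryLimit

/-- The C⋆-algebraic inductive limit of the direct system `A → A → A → ⋯` with all connecting maps
equal to `φ`: the completion of the algebra of threads, modulo threads of norm zero. -/
def StationaryLimit {A : Type*} [NonUnitalCStarAlgebra A] (φ : A →⋆ₙₐ[ℂ] A) : Type _ :=
  (StationaryLimit.seminorm φ).Completion

namespace StationaryLimit
variable {A : Type*} [NonUnitalCStarAlgebra A] (φ : A →⋆ₙₐ[ℂ] A)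

instance : NonUnitalCStarAlgebra (StationaryLimit φ) :=
  inferInstanceAs (NonUnitalCStarAlgebra (StationaryLimit.seminorm φ).Completion)

/-- The thread that starts with `a` at place `n`. -/
def thread (n : ℕ) (a : A) : Threads φ :=
  ⟨fun k => if n ≤ k then φ^[k - n] a else 0, by
    refine eventually_atTop.2 ⟨n, fun k hk => ?_⟩
    dsimp only
    rw [if_pos hk, if_pos (Nat.le_succ_of_le hk), Nat.succ_sub hk, Function.iterate_succ_apply']⟩

theorem thread_apply (n : ℕ) (a : A) (k : ℕ) :
    (thread φ n a).1 k = if n ≤ k then φ^[k - n] a else 0 := rfl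

theorem thread_smul (n : ℕ) (c : ℂ) (a : A) : thread φ n (c • a) = c • thread φ n a := by
  refine Subtype.ext (funext fun k => ?_)
  change _ = c • (thread φ n a).1 k
  rw [thread_apply, thread_apply]
  split_ifs
  · exact Function.Semiconj.iterate_right (f := (c • ·)) (fun x => (map_smul φ c x).symm) _ a |>.symm
  · rw [smul_zero]

theorem thread_zero (n : ℕ) : thread φ n 0 = 0 := by
  refine Subtype.ext (funext fun k => ?_)
  change _ = (0 : A)
  rw [thread_apply, iterate_map_zero, ite_self]

theorem thread_add (n : ℕ) (a b : A) : thread φ n (a + b) = thread φ n a + thread φ n b := by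
  refine Subtype.ext (funext fun k => ?_)
  change _ = (thread φ n a).1 k + (thread φ n b).1 k
  simp only [thread_apply]
  split_ifs
  · exact iterate_map_add φ _ a b
  · rw [add_zero]

theorem thread_mul (n : ℕ) (a b : A) : thread φ n (a * b) = thread φ n a * thread φ n b := by
  refine Subtype.ext (funext fun k => ?_)
  change _ = (thread φ n a).1 k * (thread φ n b).1 k
  simp only [thread_apply]
  split_ifs
  · exact iterate_map_mul φ _ a b
  · rw [mul_zero]

theorem thread_star (n : ℕ) (a : A) : thread φ n (star a) = star (thread φ n a) := by
  refine Subtype.ext (funext fun k => ?_)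
  change _ = star ((thread φ n a).1 k)
  simp only [thread_apply]
  split_ifs
  · exact Function.Semiconj.iterate_right (f := (star : A → A)) (fun x => (map_star φ x).symm) _ a
      |>.symm
  · rw [star_zero]

/-- The canonical ⋆-homomorphism of the `n`-th copy of `A` into the inductive limit. -/
def ι (n : ℕ) : A →⋆ₙₐ[ℂ] StationaryLimit φ where
  toFun a := (seminorm φ).toCompletion (thread φ n a)
  map_smul' c a := by
    rw [thread_smul]; exact (seminorm φ).toCompletion_smul c _
  map_zero' := by
    rw [thread_zero]; exact (seminorm φ).toCompletion_zero
  map_add' a b := by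
    rw [thread_add]; exact (seminorm φ).toCompletion_add _ _
  map_mul' a b := by
    rw [thread_mul]; exact (seminorm φ).toCompletion_mul _ _
  map_star' a := by
    rw [thread_star]; exact (seminorm φ).toCompletion_star _

end StationaryLimit

/-! ### Compact operators and the tensor product -/

/-- The adjoint of a compact operator on a Hilbert space is compact. -/
theorem isCompactOperator_star {H : Type*} [NormedAddCommGroup H]
    [InnerProductSpace ℂ H] [CompleteSpace H] {T : H →L[ℂ] H} (hT : IsCompactOperator T) :
    IsCompactOperator (star T : H →L[ℂ] H) := by
  set T' : H →L[ℂ] H := star T with hT'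
  have hR : IsCompactOperator (T ∘L T') := hT.comp_clm T'
  have hRt : TotallyBounded ((T ∘L T') '' Metric.closedBall 0 1) :=
    (IsCompactOperator.isCompact_closure_image_closedBall (f := (T ∘L T').toLinearMap) hR
      1).totallyBounded.subset subset_closure
  have key : TotallyBounded (T' '' Metric.closedBall 0 1) := by
    rw [Metric.totallyBounded_iff]
    intro ε hε
    obtain ⟨t, hts, htf, ht⟩ :=
      Metric.finite_approx_of_totallyBounded hRt (ε ^ 2 / 4) (by positivity)
    choose! g hg using fun y (hy : y ∈ t) => hts hy
    refine ⟨(fun y => T' (g y)) '' t, htf.image _, ?_⟩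
    rintro _ ⟨x, hx, rfl⟩
    obtain ⟨y, hy, hxy⟩ := Set.mem_iUnion₂.1 (ht ⟨x, hx, rfl⟩)
    refine Set.mem_iUnion₂.2 ⟨_, ⟨y, hy, rfl⟩, ?_⟩
    have hgy := hg y hy
    rw [← hgy.2, Metric.mem_ball, dist_eq_norm, ← map_sub] at hxy
    rw [Metric.mem_ball, dist_eq_norm, ← map_sub]
    have hn : ‖x - g y‖ ≤ 2 := by
      have h1 : ‖x‖ ≤ 1 := by simpa using hx
      have h2 : ‖g y‖ ≤ 1 := by simpa using hgy.1
      exact (norm_sub_le _ _).trans (by linarith)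
    have hsq : ‖T' (x - g y)‖ ^ 2 ≤ ‖(T ∘L T') (x - g y)‖ * ‖x - g y‖ := by
      have h := ContinuousLinearMap.apply_norm_sq_eq_inner_adjoint_left T' (x - g y)
      rw [h]
      refine (Complex.re_le_norm _).trans ((norm_inner_le_norm _ _).trans (le_of_eq ?_))
      rw [hT', ContinuousLinearMap.star_eq_adjoint, ContinuousLinearMap.adjoint_adjoint]
    have : ‖T' (x - g y)‖ ^ 2 < ε ^ 2 := by
      nlinarith [norm_nonneg (x - g y), norm_nonneg ((T ∘L T') (x - g y)), sq_nonneg ε]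
    exact lt_of_pow_lt_pow_left₀ 2 hε.le this
  exact (isCompactOperator_iff_isCompact_closure_image_closedBall T'.toLinearMap one_pos).2
    (key.closure.isCompact_of_isClosed isClosed_closure)

/-- The C⋆-algebra `𝒦(H)` of compact operators on a Hilbert space. -/
def compactOperators (H : Type*) [NormedAddCommGroup H] [InnerProductSpace ℂ H]
    [CompleteSpace H] : NonUnitalStarSubalgebra ℂ (H →L[ℂ] H) where
  carrier := {T | IsCompactOperator T}
  add_mem' hS hT := hS.add hT
  zero_mem' := isCompactOperator_zero
  mul_mem' {_ T} hS _ := IsCompactOperator.comp_clm hS T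
  smul_mem' c _ hT := hT.smul c
  star_mem' hT := isCompactOperator_star hT

instance (H : Type*) [NormedAddCommGroup H] [InnerProductSpace ℂ H] [CompleteSpace H] :
    NonUnitalCStarAlgebra (compactOperators H) :=
  NonUnitalStarSubalgebra.nonUnitalCStarAlgebra (compactOperators H)
    (h_closed := isClosed_setOfPred_isCompactOperator)

section tensor
variable (A B : Type*) [NonUnitalCStarAlgebra A] [NonUnitalCStarAlgebra B]

/-- The involution `(a ⊗ b)⋆ = a⋆ ⊗ b⋆` makes the algebraic tensor product a ⋆-algebra. -/
instance algTensorStarRing : StarRing (A ⊗[ℂ] B) where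
  star_mul x y := by
    induction x using TensorProduct.induction_on with
    | zero => simp
    | add x₁ x₂ h₁ h₂ => rw [add_mul, star_add, h₁, h₂, star_add, mul_add]
    | tmul a b =>
      induction y using TensorProduct.induction_on with
      | zero => simp
      | add y₁ y₂ h₁ h₂ => rw [mul_add, star_add, h₁, h₂, star_add, add_mul]
      | tmul c d => simp
  star_add := star_add

/-- The C⋆-seminorms on the algebraic tensor product. The inequality `p (a ⊗ b) ≤ ‖a‖ ‖b‖` is in fact
satisfied by every C⋆-seminorm; it is listed because it makes the supremum visibly finite. -/
def tensorSeminorms : Set (CStarSeminorm (A ⊗[ℂ] B)) :=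
  {p | ∀ a b, p (a ⊗ₜ[ℂ] b) ≤ ‖a‖ * ‖b‖}

theorem tensorSeminorms_nonempty : (tensorSeminorms A B).Nonempty :=
  ⟨{ (0 : Seminorm ℂ (A ⊗[ℂ] B)) with
      mul_le' := fun x y => by
        change (0 : ℝ) ≤ 0 * 0
        simp
      star_mul_self' := fun x => by
        change (0 : ℝ) = 0 * 0
        simp }, fun a b => mul_nonneg (norm_nonneg a) (norm_nonneg b)⟩

theorem tensorSeminorms_bdd (x : A ⊗[ℂ] B) : ∃ C : ℝ, ∀ p ∈ tensorSeminorms A B, p x ≤ C := by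
  induction x using TensorProduct.induction_on with
  | zero => exact ⟨0, fun p _ => (map_zero p.toSeminorm).le⟩
  | tmul a b => exact ⟨‖a‖ * ‖b‖, fun p hp => hp a b⟩
  | add x y hx hy =>
    obtain ⟨C, hC⟩ := hx
    obtain ⟨D, hD⟩ := hy
    exact ⟨C + D, fun p hp =>
      (map_add_le_add p.toSeminorm x y).trans (add_le_add (hC p hp) (hD p hp))⟩

/-- The largest C⋆-seminorm on the algebraic tensor product. -/
def maxTensorSeminorm : CStarSeminorm (A ⊗[ℂ] B) :=
  CStarSeminorm.sup (tensorSeminorms A B) (tensorSeminorms_nonempty A B) (tensorSeminorms_bdd A B)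

/-- The maximal C⋆-tensor product: the completion of the algebraic tensor product in its largest
C⋆-seminorm. If one of the factors is nuclear, for example `𝒦(H)`, then the algebraic tensor product
carries only one C⋆-norm, and this is the completion in that norm. -/
def CStarTensor : Type _ := (maxTensorSeminorm A B).Completion

instance : NonUnitalCStarAlgebra (CStarTensor A B) :=
  inferInstanceAs (NonUnitalCStarAlgebra (maxTensorSeminorm A B).Completion)

variable {A B}

/-- The elementary tensor `a ⊗ b`. -/
def CStarTensor.tmul (a : A) (b : B) : CStarTensor A B :=
  (maxTensorSeminorm A B).toCompletion (a ⊗ₜ[ℂ] b)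

end tensor

/-- The Hilbert space `ℓ²(ℕ)`. -/
abbrev EllTwo : Type := lp (fun _ : ℕ => ℂ) 2

/-- The matrix unit `e_{k,l} : ξ ↦ ⟨ε_l, ξ⟩ ε_k` of `𝒦(ℓ²(ℕ))`, for the standard orthonormal basis
`(ε_n)`. -/
def matrixUnit (k l : ℕ) : compactOperators EllTwo :=
  ⟨InnerProductSpace.rankOne ℂ (lp.single 2 k (1 : ℂ) : EllTwo) (lp.single 2 l (1 : ℂ) : EllTwo), by
    change IsCompactOperator _
    rw [InnerProductSpace.rankOne_def']
    have h : IsCompactOperator (innerSL ℂ (lp.single 2 l (1 : ℂ) : EllTwo)) :=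
      isCompactOperator_of_locallyCompactSpace_dom (M₂ := ℂ) _
    exact h.clm_comp (ContinuousLinearMap.toSpanSingleton ℂ _)⟩

/-! ### Matrix algebras -/

section matrices
variable {A : Type*}

/-- The inclusion `M_n(A) → 𝒦(ℓ²(ℕ)) ⊗ A` as the upper left corner,
`(a_{k,l}) ↦ ∑_{k,l} e_{k,l} ⊗ a_{k,l}`. -/
def cornerToStabilization [NonUnitalCStarAlgebra A] {n : ℕ} (M : CStarMatrix (Fin n) (Fin n) A) :
    CStarTensor (compactOperators EllTwo) A :=
  ∑ k : Fin n, ∑ l : Fin n, CStarTensor.tmul (matrixUnit k l) (M k l)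

/-- The corner embedding `M_{2^i}(A) → M_{2^{i+1}}(A)`, `a ↦ diag(a, 0)`. -/
def cornerEmbedding [Zero A] {i : ℕ} (M : CStarMatrix (Fin (2 ^ i)) (Fin (2 ^ i)) A) :
    CStarMatrix (Fin (2 ^ (i + 1))) (Fin (2 ^ (i + 1))) A :=
  CStarMatrix.ofMatrix <| Matrix.of fun k l =>
    if h : (k : ℕ) < 2 ^ i ∧ (l : ℕ) < 2 ^ i then M ⟨k, h.1⟩ ⟨l, h.2⟩ else 0

/-- `id ⊗ θ : M_{2^i}(A) → M_{2^i}(M₂(A)) = M_{2^{i+1}}(A)`: the map `θ` is applied to every entry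
and the resulting array of `2 × 2` blocks is read as one matrix. -/
def applyEntrywise (θ : A → CStarMatrix (Fin 2) (Fin 2) A) {i : ℕ}
    (M : CStarMatrix (Fin (2 ^ i)) (Fin (2 ^ i)) A) :
    CStarMatrix (Fin (2 ^ (i + 1))) (Fin (2 ^ (i + 1))) A :=
  CStarMatrix.ofMatrix <| Matrix.of fun k l =>
    θ (M (Fin.cast (pow_succ 2 i) k).divNat (Fin.cast (pow_succ 2 i) l).divNat)
      (Fin.cast (pow_succ 2 i) k).modNat (Fin.cast (pow_succ 2 i) l).modNat

end matrices

end

/-! Put `t₀ = s` and `t₁ = u s`. The relation `s s⋆ + u s s⋆ u⋆ = 1` says that the range projections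
of these two isometries sum to `1`, and this forces the ranges to be orthogonal. For every such
Cuntz family the map `x ↦ (t_k⋆ x t_l)` is a ⋆-isomorphism onto matrices, with inverse `M ↦ ∑ t_k
M_{k,l} t_l⋆` (`IsCuntzFamily.matrixEquiv`). For the pair `s, u s` this is `ϑ_{1,2}`: the relation
`s u = u² s` turns the entries of `u` into the prescribed ones, and `s x s⋆ = t₀ x t₀⋆` lands in the
upper left corner. The universal property of `𝒬₂` is needed only for uniqueness.

Applying the isomorphism entrywise commutes with padding by zeros, so induction gives the corner
formula for every `ϑ_{2^i}` (`iterMatrixEquiv_succ_eq_cornerEmbedding`). The stationary system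
thereby becomes the system of corner embeddings `A → M₂(A) → M₄(A) → ⋯`. The corner maps into `𝒦 ⊗
A` are compatible with it and induce a map on the limit (`StationaryLimit.exists_lift`). Injective
⋆-homomorphisms of C⋆-algebras are isometric, so this map is isometric once the corner maps are
injective. Its range is then closed, and it is dense because finite truncations of a compact
operator converge in norm (`eq_top_of_cornerToStabilization_mem`).

The remaining point is injectivity of `M_n(A) → 𝒦 ⊗ A`. Since `𝒦 ⊗ A` is completed in its largest
C⋆-seminorm, it suffices to exhibit one C⋆-seminorm that controls matrix entries. It is the limit of
the norms of the compressions `T ⊗ a ↦ (⟨ε_k, T ε_l⟩ a)` to `M_n(A)` (`stabSeminorm`). A single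
compression is not multiplicative, but the defect tends to zero because `T P_n → T` in norm for
compact `T` (`tendsto_compressDefect`). -/

noncomputable section

/-! ### Matrix decompositions given by Cuntz families -/

section cuntz
variable {n A : Type*} [Fintype n] [DecidableEq n] [Ring A] [StarRing A] [Algebra ℂ A]

/-- Isometries `t i` in a ⋆-algebra with orthogonal ranges that sum up to `1`. -/
structure IsCuntzFamily (t : n → A) : Prop where
  star_mul : ∀ i j, star (t i) * t j = if i = j then 1 else 0
  sum_mul_star : ∑ i, t i * star (t i) = 1

/-- A Cuntz family identifies `A` with `M_n(A)` through `x ↦ (t_k⋆ x t_l)`. -/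
def IsCuntzFamily.matrixEquiv {t : n → A} (ht : IsCuntzFamily t) :
    A ≃⋆ₐ[ℂ] CStarMatrix n n A where
  toFun x := CStarMatrix.ofMatrix <| Matrix.of fun k l => star (t k) * x * t l
  invFun M := ∑ k, ∑ l, t k * M k l * star (t l)
  left_inv x := by
    calc ∑ k, ∑ l, t k * (star (t k) * x * t l) * star (t l)
        = (∑ k, t k * star (t k)) * x * ∑ l, t l * star (t l) := by
          simp only [Finset.sum_mul, Finset.mul_sum, mul_assoc]
          exact Finset.sum_comm
      _ = x := by rw [ht.sum_mul_star, one_mul, mul_one]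
  right_inv M := by
    refine CStarMatrix.ext fun k l => ?_
    change star (t k) * (∑ i, ∑ j, t i * M i j * star (t j)) * t l = M k l
    have h : ∀ i j, star (t k) * (t i * M i j * star (t j)) * t l =
        (star (t k) * t i) * M i j * (star (t j) * t l) := fun i j => by
      simp only [mul_assoc]
    simp only [Finset.mul_sum, Finset.sum_mul, h, ht.star_mul]
    simp
  map_mul' x y := by
    refine CStarMatrix.ext fun k l => ?_
    rw [CStarMatrix.mul_apply]
    change star (t k) * (x * y) * t l = ∑ j, (star (t k) * x * t j) * (star (t j) * y * t l)
    calc star (t k) * (x * y) * t l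
        = star (t k) * x * (∑ j, t j * star (t j)) * y * t l := by
          rw [ht.sum_mul_star, mul_one, mul_assoc (star (t k)) x y]
      _ = _ := by simp only [Finset.sum_mul, Finset.mul_sum, mul_assoc]
  map_add' x y := by
    refine CStarMatrix.ext fun k l => ?_
    change star (t k) * (x + y) * t l = star (t k) * x * t l + star (t k) * y * t l
    rw [mul_add, add_mul]
  map_star' x := by
    refine CStarMatrix.ext fun k l => ?_
    change star (t k) * star x * t l = star (star (t l) * x * t k)
    simp [mul_assoc]
  map_smul' c x := by
    refine CStarMatrix.ext fun k l => ?_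
    change star (t k) * (c • x) * t l = c • (star (t k) * x * t l)
    simp

theorem IsCuntzFamily.matrixEquiv_apply {t : n → A} (ht : IsCuntzFamily t) (x : A) (k l : n) :
    ht.matrixEquiv x k l = star (t k) * x * t l := rfl

end cuntz

/-! ### The Cuntz family `s, u s` and the matrices of `u`, `s` and `s x s⋆` -/

section relations
variable {A : Type*} [Ring A] [StarRing A] {u s : A}

/-- Sandwiching the range relation between `s⋆` and `u s` gives `y + y = y` for `y = s⋆ u s`.
Orthogonality of the two ranges is thus a consequence of the relations, with no appeal to
positivity. -/
theorem Q2Relations.star_s_mul_u_mul_s (h : Q2Relations u s) : star s * (u * s) = 0 := by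
  have h1 : star s * (s * star s + u * (s * star s) * star u) * (u * s) = star s * (u * s) := by
    rw [h.range_sum, mul_one]
  have hu : ∀ z, star u * (u * z) = z := fun z => by rw [← mul_assoc, h.star_mul_u, one_mul]
  have hs : ∀ z, star s * (s * z) = z := fun z => by rw [← mul_assoc, h.star_mul_s, one_mul]
  simp only [mul_add, add_mul, mul_assoc, hu, hs, h.star_mul_s, mul_one] at h1
  simpa using h1

theorem Q2Relations.isCuntzFamily (h : Q2Relations u s) : IsCuntzFamily ![s, u * s] where
  star_mul i j := by
    have h0 := h.star_s_mul_u_mul_s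
    have hu : ∀ z, star u * (u * z) = z := fun z => by rw [← mul_assoc, h.star_mul_u, one_mul]
    have h1 : star (u * s) * s = 0 := by
      simpa [mul_assoc] using congrArg star h0
    fin_cases i <;> fin_cases j
    · simpa using h.star_mul_s
    · simpa using h0
    · simpa using h1
    · simpa [mul_assoc, hu] using h.star_mul_s
  sum_mul_star := by
    simpa [mul_assoc] using h.range_sum

variable [Algebra ℂ A]

/-- The only entry that uses the commutation relation is the upper right one: `s⋆ u (u s) = s⋆ s u =
u`. Both diagonal entries reduce to `s⋆ u s = 0`. -/
theorem Q2Relations.matrixEquiv_u (h : Q2Relations u s) :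
    h.isCuntzFamily.matrixEquiv u = CStarMatrix.ofMatrix !![0, u; 1, 0] := by
  have h0 := h.star_s_mul_u_mul_s
  have hu : ∀ z, star u * (u * z) = z := fun z => by rw [← mul_assoc, h.star_mul_u, one_mul]
  have hs : ∀ z, star s * (s * z) = z := fun z => by rw [← mul_assoc, h.star_mul_s, one_mul]
  have hsu : s * u = u * (u * s) := by rw [h.s_mul_u, pow_two, mul_assoc]
  refine CStarMatrix.ext fun k l => ?_
  rw [h.isCuntzFamily.matrixEquiv_apply]
  fin_cases k <;> fin_cases l
  · simpa [mul_assoc] using h0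
  · simp [mul_assoc, ← hsu, hs]
  · simp [mul_assoc, hu, h.star_mul_s]
  · simp [mul_assoc, hu, h0]

theorem Q2Relations.matrixEquiv_s (h : Q2Relations u s) :
    h.isCuntzFamily.matrixEquiv s = CStarMatrix.ofMatrix !![s, u * s; 0, 0] := by
  have h0 := h.isCuntzFamily.star_mul 1 0
  have hs : ∀ z, star s * (s * z) = z := fun z => by rw [← mul_assoc, h.star_mul_s, one_mul]
  have h1 : star s * (star u * s) = 0 := by simpa [mul_assoc] using h0
  have h2 : ∀ z, star s * (star u * (s * z)) = 0 := fun z => by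
    rw [← mul_assoc (star u), ← mul_assoc, h1, zero_mul]
  refine CStarMatrix.ext fun k l => ?_
  rw [h.isCuntzFamily.matrixEquiv_apply]
  fin_cases k <;> fin_cases l
  · simp [mul_assoc, hs]
  · simp [mul_assoc, hs]
  · simp [mul_assoc, h2]
  · simp [mul_assoc, h2]

/-- Because `s` is the member `t₀` of the family, the entry is `(t_k⋆ t₀) x (t₀⋆ t_l)`, and
orthonormality of the family decides it. -/
theorem Q2Relations.matrixEquiv_conj (h : Q2Relations u s) (x : A) (k l : Fin 2) :
    h.isCuntzFamily.matrixEquiv (s * x * star s) k l = if k = 0 ∧ l = 0 then x else 0 := by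
  have h0 := h.isCuntzFamily.star_mul
  have h1 : h.isCuntzFamily.matrixEquiv (s * x * star s) k l =
      (star (![s, u * s] k) * ![s, u * s] 0) * x * (star (![s, u * s] 0) * ![s, u * s] l) := by
    simp [h.isCuntzFamily.matrixEquiv_apply, mul_assoc]
  rw [h1, h0, h0]
  fin_cases k <;> fin_cases l <;> simp

end relations

/-! ### Entrywise application of a map into `2 × 2` matrices -/

section entrywise
variable {A : Type*} {i : ℕ}

/-- Positions in `Fin (2 ^ (i + 1))` as pairs of a block and a place in the block. -/
def blockEquiv (i : ℕ) : Fin (2 ^ (i + 1)) ≃ Fin (2 ^ i) × Fin 2 :=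
  (finCongr (pow_succ 2 i)).trans finProdFinEquiv.symm

theorem blockEquiv_fst (k : Fin (2 ^ (i + 1))) : ((blockEquiv i k).1 : ℕ) = k / 2 := rfl

theorem blockEquiv_snd (k : Fin (2 ^ (i + 1))) : ((blockEquiv i k).2 : ℕ) = k % 2 := rfl

theorem applyEntrywise_apply (θ : A → CStarMatrix (Fin 2) (Fin 2) A)
    (M : CStarMatrix (Fin (2 ^ i)) (Fin (2 ^ i)) A) (k l : Fin (2 ^ (i + 1))) :
    applyEntrywise θ M k l =
      θ (M (blockEquiv i k).1 (blockEquiv i l).1) (blockEquiv i k).2 (blockEquiv i l).2 := rfl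

theorem cornerEmbedding_apply [Zero A] (M : CStarMatrix (Fin (2 ^ i)) (Fin (2 ^ i)) A)
    (k l : Fin (2 ^ (i + 1))) : cornerEmbedding M k l =
      if h : (k : ℕ) < 2 ^ i ∧ (l : ℕ) < 2 ^ i then M ⟨k, h.1⟩ ⟨l, h.2⟩ else 0 := rfl

/-- The one-member family `{1}` supplies the identification `A ≅ M_1(A)` from which the recursion
for `ϑ_{2^i}` starts. -/
theorem isCuntzFamily_one [Ring A] [StarRing A] : IsCuntzFamily fun _ : Fin (2 ^ 0) => (1 : A) where
  star_mul i j := by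
    have : i = j := Subsingleton.elim (α := Fin 1) i j
    simp [this]
  sum_mul_star := by simp

variable [Ring A] [StarRing A] [Algebra ℂ A]

/-- `applyEntrywise` as a ⋆-homomorphism. -/
def applyEntrywiseHom (θ : A ≃⋆ₐ[ℂ] CStarMatrix (Fin 2) (Fin 2) A) (i : ℕ) :
    CStarMatrix (Fin (2 ^ i)) (Fin (2 ^ i)) A →⋆ₙₐ[ℂ]
      CStarMatrix (Fin (2 ^ (i + 1))) (Fin (2 ^ (i + 1))) A where
  toFun := applyEntrywise θ
  map_smul' c M := by
    refine CStarMatrix.ext fun k l => ?_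
    simp only [applyEntrywise_apply, CStarMatrix.smul_apply, map_smul, MonoidHom.id_apply]
  map_zero' := by
    refine CStarMatrix.ext fun k l => ?_
    simp only [applyEntrywise_apply, CStarMatrix.zero_apply, map_zero]
  map_add' M N := by
    refine CStarMatrix.ext fun k l => ?_
    simp only [applyEntrywise_apply, CStarMatrix.add_apply, map_add]
  map_mul' M N := by
    refine CStarMatrix.ext fun k l => ?_
    have hsum : ∀ (f : Fin (2 ^ i) → CStarMatrix (Fin 2) (Fin 2) A) (a b : Fin 2),
        (∑ j, f j) a b = ∑ j, f j a b := fun f a b => by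
      induction (Finset.univ : Finset (Fin (2 ^ i))) using Finset.induction_on with
      | empty => rfl
      | insert j s hj ih =>
        rw [Finset.sum_insert hj, Finset.sum_insert hj, CStarMatrix.add_apply, ih]
    -- Block multiplication: the sum over positions of the large matrix is split into a sum over
    -- blocks and a sum over the two places within a block.
    rw [applyEntrywise_apply, CStarMatrix.mul_apply, CStarMatrix.mul_apply, map_sum, hsum,
      ← (blockEquiv i).symm.sum_comp, Fintype.sum_prod_type]
    refine Finset.sum_congr rfl fun j _ => ?_
    rw [map_mul, CStarMatrix.mul_apply]
    refine Finset.sum_congr rfl fun r _ => ?_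
    simp only [applyEntrywise_apply, Equiv.apply_symm_apply]
  map_star' M := by
    refine CStarMatrix.ext fun k l => ?_
    simp only [applyEntrywise_apply, CStarMatrix.star_apply, map_star]

/-- A preimage is found by cutting the matrix into `2 × 2` blocks and applying `θ.symm` to each
block. -/
theorem applyEntrywiseHom_bijective (θ : A ≃⋆ₐ[ℂ] CStarMatrix (Fin 2) (Fin 2) A) (i : ℕ) :
    Function.Bijective (applyEntrywiseHom θ i) := by
  constructor
  · refine fun M N h => CStarMatrix.ext fun k l =>
      EquivLike.injective θ (CStarMatrix.ext fun a b => ?_)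
    have := CStarMatrix.ext_iff.2 h ((blockEquiv i).symm (k, a)) ((blockEquiv i).symm (l, b))
    change applyEntrywise θ M _ _ = applyEntrywise θ N _ _ at this
    simpa only [applyEntrywise_apply, Equiv.apply_symm_apply] using this
  · refine fun N => ⟨CStarMatrix.ofMatrix <| Matrix.of fun k l =>
      θ.symm (CStarMatrix.ofMatrix <| Matrix.of fun a b =>
        N ((blockEquiv i).symm (k, a)) ((blockEquiv i).symm (l, b))),
      CStarMatrix.ext fun k l => ?_⟩
    change applyEntrywise θ _ k l = _
    rw [applyEntrywise_apply]
    simp only [CStarMatrix.ofMatrix_apply, Matrix.of_apply, StarAlgEquiv.apply_symm_apply,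
      Prod.mk.eta, Equiv.symm_apply_apply]

/-- The iterates `ϑ_{2^i}` of a ⋆-isomorphism `A ≅ M₂(A)`. -/
def iterMatrixEquiv (θ : A ≃⋆ₐ[ℂ] CStarMatrix (Fin 2) (Fin 2) A) :
    ∀ i : ℕ, A ≃⋆ₐ[ℂ] CStarMatrix (Fin (2 ^ i)) (Fin (2 ^ i)) A
  | 0 => (isCuntzFamily_one (A := A)).matrixEquiv
  | i + 1 => (iterMatrixEquiv θ i).trans
      (StarAlgEquiv.ofBijective (applyEntrywiseHom θ i) (applyEntrywiseHom_bijective θ i))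

theorem iterMatrixEquiv_zero_apply (θ : A ≃⋆ₐ[ℂ] CStarMatrix (Fin 2) (Fin 2) A) (x : A)
    (k l : Fin (2 ^ 0)) : iterMatrixEquiv θ 0 x k l = x := by
  refine (IsCuntzFamily.matrixEquiv_apply isCuntzFamily_one x k l).trans ?_
  rw [star_one, one_mul, mul_one]

theorem iterMatrixEquiv_succ_apply (θ : A ≃⋆ₐ[ℂ] CStarMatrix (Fin 2) (Fin 2) A) (i : ℕ) (x : A) :
    iterMatrixEquiv θ (i + 1) x = applyEntrywise θ (iterMatrixEquiv θ i x) := rfl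

/-- The block index `k / 2` lies below `2 ^ i` exactly when `k` lies below `2 ^ (i + 1)`, and `θ`
sends the padding zeros to zero blocks. -/
theorem applyEntrywise_cornerEmbedding (θ : A ≃⋆ₐ[ℂ] CStarMatrix (Fin 2) (Fin 2) A)
    (M : CStarMatrix (Fin (2 ^ i)) (Fin (2 ^ i)) A) :
    applyEntrywise θ (cornerEmbedding M) = cornerEmbedding (applyEntrywise θ M) := by
  refine CStarMatrix.ext fun k l => ?_
  have h : ∀ k : Fin (2 ^ (i + 1 + 1)), ((blockEquiv (i + 1) k).1 : ℕ) < 2 ^ i ↔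
      (k : ℕ) < 2 ^ (i + 1) := fun k => by
    have := pow_succ 2 i
    rw [blockEquiv_fst]; omega
  rw [applyEntrywise_apply, cornerEmbedding_apply, cornerEmbedding_apply]
  by_cases hkl : (k : ℕ) < 2 ^ (i + 1) ∧ (l : ℕ) < 2 ^ (i + 1)
  · rw [dif_pos hkl, dif_pos ⟨(h k).2 hkl.1, (h l).2 hkl.2⟩]
    rfl
  · rw [dif_neg hkl, dif_neg fun h' => hkl ⟨(h k).1 h'.1, (h l).1 h'.2⟩, map_zero]
    rfl

/-- The recursion refines matrices at the innermost level, whereas the corner sits at the outermost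
one. The hypothesis on `φ` therefore settles only the first stage; later stages follow because
entrywise application commutes with the corner embedding. -/
theorem iterMatrixEquiv_succ_eq_cornerEmbedding (θ : A ≃⋆ₐ[ℂ] CStarMatrix (Fin 2) (Fin 2) A)
    (φ : A → A) (hφ : ∀ x k l, θ (φ x) k l = if k = 0 ∧ l = 0 then x else 0) (i : ℕ) (x : A) :
    iterMatrixEquiv θ (i + 1) (φ x) = cornerEmbedding (iterMatrixEquiv θ i x) := by
  induction i with
  | zero =>
    refine CStarMatrix.ext fun k l => ?_
    rw [iterMatrixEquiv_succ_apply, applyEntrywise_apply, iterMatrixEquiv_zero_apply, hφ,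
      cornerEmbedding_apply]
    have h : ∀ k : Fin (2 ^ (0 + 1)), (blockEquiv 0 k).2 = 0 ↔ (k : ℕ) < 2 ^ 0 := fun k => by
      have := k.2
      rw [Fin.ext_iff, blockEquiv_snd]
      simp at this ⊢
      omega
    simp only [h, iterMatrixEquiv_zero_apply, dite_eq_ite]
  | succ i ih =>
    rw [iterMatrixEquiv_succ_apply, ih, applyEntrywise_cornerEmbedding,
      ← iterMatrixEquiv_succ_apply]

end entrywise

/-! ### Truncation of compact operators on `ℓ²` -/

/-- The standard orthonormal basis of `ℓ²(ℕ)`. -/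
def stdVec (n : ℕ) : EllTwo := lp.single 2 n (1 : ℂ)

theorem inner_stdVec (n : ℕ) (x : EllTwo) : inner ℂ (stdVec n) x = x n := by
  rw [stdVec, lp.inner_single_left]
  simp

theorem stdVec_apply (m n : ℕ) : stdVec n m = if m = n then 1 else 0 := by
  rw [stdVec, lp.single_apply, Pi.single_apply]

theorem inner_stdVec_stdVec (m n : ℕ) :
    inner ℂ (stdVec m) (stdVec n) = if m = n then (1 : ℂ) else 0 := by
  rw [inner_stdVec, stdVec_apply]

theorem matrixUnit_coe (k l : ℕ) : (matrixUnit k l : EllTwo →L[ℂ] EllTwo) =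
    InnerProductSpace.rankOne ℂ (stdVec k) (stdVec l) := rfl

theorem matrixUnit_apply (k l : ℕ) (x : EllTwo) :
    (matrixUnit k l : EllTwo →L[ℂ] EllTwo) x = x l • stdVec k := by
  rw [matrixUnit_coe, InnerProductSpace.rankOne_apply, inner_stdVec]

theorem star_matrixUnit (k l : ℕ) : star (matrixUnit k l) = matrixUnit l k := by
  refine Subtype.ext ?_
  change star (matrixUnit k l : EllTwo →L[ℂ] EllTwo) = _
  rw [ContinuousLinearMap.star_eq_adjoint, matrixUnit_coe, matrixUnit_coe,
    InnerProductSpace.adjoint_rankOne]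

theorem matrixUnit_mul (k l p q : ℕ) :
    matrixUnit k l * matrixUnit p q = if l = p then matrixUnit k q else 0 := by
  refine Subtype.ext (ContinuousLinearMap.ext fun x => ?_)
  change (matrixUnit k l : EllTwo →L[ℂ] EllTwo) ((matrixUnit p q : EllTwo →L[ℂ] EllTwo) x) = _
  rw [matrixUnit_apply, matrixUnit_apply]
  split_ifs with h
  · rw [matrixUnit_apply]
    simp [stdVec_apply, h]
  · simp [stdVec_apply, h]

/-- The isometry `ℂⁿ → ℓ²(ℕ)` onto the span of the first `n` basis vectors. -/
def stdEmbed (n : ℕ) : EuclideanSpace ℂ (Fin n) →L[ℂ] EllTwo :=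
  ∑ i : Fin n, InnerProductSpace.rankOne ℂ (stdVec i) (EuclideanSpace.single i (1 : ℂ))

theorem stdEmbed_apply (n : ℕ) (y : EuclideanSpace ℂ (Fin n)) :
    stdEmbed n y = ∑ i : Fin n, y i • stdVec i := by
  rw [stdEmbed, sum_apply]
  refine Finset.sum_congr rfl fun i _ => ?_
  rw [InnerProductSpace.rankOne_apply, EuclideanSpace.inner_single_left, map_one, one_mul]

theorem stdEmbed_single (n : ℕ) (j : Fin n) :
    stdEmbed n (EuclideanSpace.single j 1) = stdVec j := by
  rw [stdEmbed_apply, Finset.sum_eq_single j]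
  · simp
  · intro i _ hij
    simp [hij]
  · simp

theorem adjoint_stdEmbed_apply (n : ℕ) (x : EllTwo) (j : Fin n) :
    (stdEmbed n).adjoint x j = x j := by
  have h : inner ℂ (EuclideanSpace.single j (1 : ℂ)) ((stdEmbed n).adjoint x) = x j := by
    rw [ContinuousLinearMap.adjoint_inner_right, stdEmbed_single, inner_stdVec]
  rwa [EuclideanSpace.inner_single_left, map_one, one_mul] at h

theorem adjoint_stdEmbed_comp (n : ℕ) :
    (stdEmbed n).adjoint ∘L stdEmbed n = ContinuousLinearMap.id ℂ _ := by
  refine ContinuousLinearMap.coe_injective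
    ((EuclideanSpace.basisFun (Fin n) ℂ).toBasis.ext fun j => ?_)
  ext i
  simp only [OrthonormalBasis.coe_toBasis, EuclideanSpace.basisFun_apply,
    ContinuousLinearMap.coe_coe, ContinuousLinearMap.comp_apply, ContinuousLinearMap.id_apply,
    stdEmbed_single, adjoint_stdEmbed_apply, stdVec_apply]
  simp [Fin.ext_iff]

theorem norm_stdEmbed_le (n : ℕ) : ‖stdEmbed n‖ ≤ 1 := by
  refine (stdEmbed n).opNorm_le_bound zero_le_one fun x => ?_
  have h : ‖stdEmbed n x‖ ^ 2 = ‖x‖ ^ 2 := by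
    rw [ContinuousLinearMap.apply_norm_sq_eq_inner_adjoint_left, adjoint_stdEmbed_comp]
    exact inner_self_eq_norm_sq x
  rw [one_mul]
  exact (pow_le_pow_iff_left₀ (norm_nonneg _) (norm_nonneg _) two_ne_zero).1 h.le

/-- The projection of `ℓ²(ℕ)` onto the span of the first `n` basis vectors. -/
def stdProj (n : ℕ) : EllTwo →L[ℂ] EllTwo := stdEmbed n ∘L (stdEmbed n).adjoint

theorem norm_stdProj_le (n : ℕ) : ‖stdProj n‖ ≤ 1 := by
  refine (ContinuousLinearMap.opNorm_comp_le _ _).trans ?_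
  rw [LinearIsometryEquiv.norm_map]
  exact mul_le_one₀ (norm_stdEmbed_le n) (norm_nonneg _) (norm_stdEmbed_le n)

theorem adjoint_stdProj (n : ℕ) : (stdProj n).adjoint = stdProj n := by
  rw [stdProj, ContinuousLinearMap.adjoint_comp, ContinuousLinearMap.adjoint_adjoint]

theorem stdProj_apply (n : ℕ) (x : EllTwo) :
    stdProj n x = ∑ i ∈ Finset.range n, x i • stdVec i := by
  rw [Finset.sum_range, stdProj, ContinuousLinearMap.comp_apply, stdEmbed_apply]
  simp only [adjoint_stdEmbed_apply]

theorem tendsto_stdProj (x : EllTwo) : Tendsto (fun n => stdProj n x) atTop (𝓝 x) := by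
  have h := (lp.hasSum_single (p := 2) (by simp) x).tendsto_sum_nat
  refine h.congr fun n => ?_
  rw [stdProj_apply]
  refine Finset.sum_congr rfl fun i _ => ?_
  rw [stdVec, ← lp.single_smul, smul_eq_mul, mul_one]

/-- The projections converge only strongly to the identity, but they are contractions. Strong
convergence is therefore uniform on the totally bounded image of the unit ball under `T`, as a
finite net shows. -/
theorem tendsto_stdProj_comp {T : EllTwo →L[ℂ] EllTwo} (hT : IsCompactOperator T) :
    Tendsto (fun n => stdProj n ∘L T) atTop (𝓝 T) := by
  rw [Metric.tendsto_atTop]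
  intro ε hε
  have hK : TotallyBounded (T '' Metric.closedBall 0 1) :=
    (IsCompactOperator.isCompact_closure_image_closedBall (f := T.toLinearMap) hT
      1).totallyBounded.subset subset_closure
  obtain ⟨t, -, htf, ht⟩ := Metric.finite_approx_of_totallyBounded hK (ε / 4) (by positivity)
  have hev : ∀ᶠ n in atTop, ∀ y ∈ t, ‖stdProj n y - y‖ < ε / 4 := by
    refine (eventually_all_finite htf).2 fun y _ => ?_
    have := Metric.tendsto_nhds.1 (tendsto_stdProj y) (ε / 4) (by positivity)
    simpa only [dist_eq_norm] using this
  obtain ⟨N, hN⟩ := eventually_atTop.1 hev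
  refine ⟨N, fun n hn => ?_⟩
  rw [dist_eq_norm]
  -- Three errors of at most `ε / 4`: replacing `T x` by a net point before projecting, projecting
  -- the net point, and returning to `T x`. The unused quarter makes the final inequality strict.
  refine lt_of_le_of_lt (ContinuousLinearMap.opNorm_le_of_unit_norm (C := 3 * (ε / 4))
    (by positivity) fun x hx => ?_) (by linarith)
  obtain ⟨y, hy, hxy⟩ := Set.mem_iUnion₂.1
    (ht ⟨x, by simp [hx], rfl⟩)
  rw [Metric.mem_ball, dist_eq_norm] at hxy
  have h1 : ‖stdProj n (T x - y)‖ ≤ ε / 4 :=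
    ((stdProj n).le_of_opNorm_le (norm_stdProj_le n) _).trans (by linarith)
  have h2 := hN n hn y hy
  have h3 : (stdProj n ∘L T - T) x =
      stdProj n (T x - y) + (stdProj n y - y) - (T x - y) := by
    simp only [sub_apply, ContinuousLinearMap.comp_apply, map_sub]
    abel
  rw [h3]
  calc _ ≤ ‖stdProj n (T x - y)‖ + ‖stdProj n y - y‖ + ‖T x - y‖ :=
        (norm_sub_le _ _).trans (add_le_add_left (norm_add_le _ _) _)
    _ ≤ 3 * (ε / 4) := by linarith

/-- Taking adjoints moves the projection to the other side, since it is self-adjoint and `T⋆` is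
again compact. -/
theorem tendsto_comp_stdProj {T : EllTwo →L[ℂ] EllTwo} (hT : IsCompactOperator T) :
    Tendsto (fun n => T ∘L stdProj n) atTop (𝓝 T) := by
  have h := (continuous_star.tendsto _).comp (tendsto_stdProj_comp (isCompactOperator_star hT))
  rw [star_star] at h
  refine h.congr fun n => ?_
  change star (stdProj n * star T) = T * stdProj n
  rw [star_mul, star_star, ContinuousLinearMap.star_eq_adjoint, adjoint_stdProj]

theorem tendsto_stdProj_comp_stdProj {T : EllTwo →L[ℂ] EllTwo} (hT : IsCompactOperator T) :
    Tendsto (fun n => stdProj n ∘L T ∘L stdProj n) atTop (𝓝 T) := by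
  have h1 := tendsto_iff_norm_sub_tendsto_zero.1 (tendsto_stdProj_comp hT)
  have h2 := tendsto_iff_norm_sub_tendsto_zero.1 (tendsto_comp_stdProj hT)
  rw [tendsto_iff_norm_sub_tendsto_zero]
  refine squeeze_zero (fun _ => norm_nonneg _) (fun n => ?_) (by simpa using h2.add h1)
  have h : stdProj n ∘L T ∘L stdProj n - T =
      stdProj n ∘L (T ∘L stdProj n - T) + (stdProj n ∘L T - T) := by
    rw [ContinuousLinearMap.comp_sub]; abel
  rw [h]
  refine (norm_add_le _ _).trans (add_le_add_left ((ContinuousLinearMap.opNorm_comp_le _ _).trans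
    (mul_le_of_le_one_left (norm_nonneg _) (norm_stdProj_le n))) _)

theorem stdProj_comp_comp_stdProj (n : ℕ) (T : EllTwo →L[ℂ] EllTwo) :
    stdProj n ∘L T ∘L stdProj n = ∑ k : Fin n, ∑ l : Fin n,
      inner ℂ (stdVec k) (T (stdVec l)) • (matrixUnit k l : EllTwo →L[ℂ] EllTwo) := by
  refine ContinuousLinearMap.ext fun x => ?_
  simp only [ContinuousLinearMap.comp_apply, sum_apply, smul_apply, matrixUnit_apply, inner_stdVec]
  rw [stdProj_apply n (T _), Finset.sum_range]
  refine Finset.sum_congr rfl fun k _ => ?_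
  rw [← inner_stdVec, stdProj_apply, Finset.sum_range, map_sum, inner_sum, Finset.sum_smul]
  refine Finset.sum_congr rfl fun l _ => ?_
  rw [map_smul, inner_smul_right, inner_stdVec, smul_smul, mul_comm]

/-- The compression of an operator to the span of the first `n` basis vectors. -/
def compress (n : ℕ) (T : EllTwo →L[ℂ] EllTwo) :
    EuclideanSpace ℂ (Fin n) →L[ℂ] EuclideanSpace ℂ (Fin n) :=
  (stdEmbed n).adjoint ∘L T ∘L stdEmbed n

theorem norm_compress_le (n : ℕ) (T : EllTwo →L[ℂ] EllTwo) : ‖compress n T‖ ≤ ‖T‖ := by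
  have h : ‖(stdEmbed n).adjoint‖ ≤ 1 := by
    rw [LinearIsometryEquiv.norm_map]; exact norm_stdEmbed_le n
  refine (ContinuousLinearMap.opNorm_comp_le _ _).trans
    ((mul_le_of_le_one_left (norm_nonneg _) h).trans
      ((ContinuousLinearMap.opNorm_comp_le _ _).trans
        (mul_le_of_le_one_right (norm_nonneg _) (norm_stdEmbed_le n))))

theorem compress_sub (n : ℕ) (S T : EllTwo →L[ℂ] EllTwo) :
    compress n (S - T) = compress n S - compress n T := by
  simp only [compress, ContinuousLinearMap.sub_comp, ContinuousLinearMap.comp_sub]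

/-- The projection left in the middle is the whole obstruction to multiplicativity of compression.
-/
theorem compress_mul_compress (n : ℕ) (S T : EllTwo →L[ℂ] EllTwo) :
    compress n S * compress n T = compress n (S ∘L stdProj n ∘L T) := rfl

theorem compress_apply_single (n : ℕ) (T : EllTwo →L[ℂ] EllTwo) (i j : Fin n) :
    compress n T (EuclideanSpace.single j 1) i = inner ℂ (stdVec i) (T (stdVec j)) := by
  rw [compress, ContinuousLinearMap.comp_apply, ContinuousLinearMap.comp_apply, stdEmbed_single,
    adjoint_stdEmbed_apply, inner_stdVec]

/-! ### A C⋆-seminorm on `𝒦(ℓ²) ⊙ A` that separates matrix entries -/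

section compression
variable {A : Type*} [CStarAlgebra A]

/-- The unital ⋆-homomorphism `B(ℂⁿ) → M_n(A)`. -/
def scalarMatrix (A : Type*) [CStarAlgebra A] (n : ℕ) :
    (EuclideanSpace ℂ (Fin n) →L[ℂ] EuclideanSpace ℂ (Fin n)) →⋆ₙₐ[ℂ]
      CStarMatrix (Fin n) (Fin n) A where
  toFun T := CStarMatrix.ofMatrix <|
    (Matrix.toEuclideanCLM (n := Fin n) (𝕜 := ℂ).symm T).map (algebraMap ℂ A)
  map_smul' c T := by
    refine CStarMatrix.ext fun k l => ?_
    rw [map_smul]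
    exact (map_mul (algebraMap ℂ A) _ _).trans (Algebra.smul_def c _).symm
  map_zero' := by
    refine CStarMatrix.ext fun k l => ?_
    rw [map_zero]
    simp
  map_add' S T := by
    refine CStarMatrix.ext fun k l => ?_
    rw [map_add]
    simp
  map_mul' S T := by
    rw [map_mul, Matrix.map_mul]
    rfl
  map_star' T := by
    refine CStarMatrix.ext fun k l => ?_
    have h : (Matrix.toEuclideanCLM (n := Fin n) (𝕜 := ℂ)).symm (star T) =
        star ((Matrix.toEuclideanCLM (n := Fin n) (𝕜 := ℂ)).symm T) :=
      (Matrix.toEuclideanCLM (n := Fin n) (𝕜 := ℂ)).symm.map_star' T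
    rw [h]
    exact algebraMap_star_comm _

theorem toEuclideanCLM_symm_apply {n : ℕ}
    (T : EuclideanSpace ℂ (Fin n) →L[ℂ] EuclideanSpace ℂ (Fin n)) (i j : Fin n) :
    Matrix.toEuclideanCLM (n := Fin n) (𝕜 := ℂ).symm T i j = T (EuclideanSpace.single j 1) i := by
  obtain ⟨M, rfl⟩ := EquivLike.surjective (Matrix.toEuclideanCLM (n := Fin n) (𝕜 := ℂ)) T
  rw [StarAlgEquiv.symm_apply_apply, Matrix.ofLp_toEuclideanCLM]
  simp

theorem scalarMatrix_apply {n : ℕ}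
    (T : EuclideanSpace ℂ (Fin n) →L[ℂ] EuclideanSpace ℂ (Fin n)) (i j : Fin n) :
    scalarMatrix A n T i j = (T (EuclideanSpace.single j 1) i : ℂ) • (1 : A) := by
  rw [← toEuclideanCLM_symm_apply, ← Algebra.algebraMap_eq_smul_one]
  rfl

/-- The diagonal embedding `A → M_n(A)`. -/
def constDiag (A : Type*) [CStarAlgebra A] (n : ℕ) : A →⋆ₙₐ[ℂ] CStarMatrix (Fin n) (Fin n) A where
  toFun a := CStarMatrix.ofMatrix (Matrix.diagonal fun _ => a)
  map_smul' c a := by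
    refine CStarMatrix.ext fun k l => ?_
    simp [Matrix.diagonal_apply]
  map_zero' := by
    refine CStarMatrix.ext fun k l => ?_
    simp
  map_add' a b := by
    refine CStarMatrix.ext fun k l => ?_
    simp only [CStarMatrix.ofMatrix_apply, CStarMatrix.add_apply, Matrix.diagonal_apply]
    split_ifs <;> simp
  map_mul' a b := by
    rw [← Matrix.diagonal_mul_diagonal]
    rfl
  map_star' a := by
    refine CStarMatrix.ext fun k l => ?_
    simp only [CStarMatrix.ofMatrix_apply, CStarMatrix.star_apply, Matrix.diagonal_apply,
      eq_comm (a := k)]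
    split_ifs <;> simp

theorem mul_constDiag_apply {n : ℕ} (M : CStarMatrix (Fin n) (Fin n) A) (a : A) (i j : Fin n) :
    (M * constDiag A n a) i j = M i j * a :=
  Matrix.mul_diagonal (fun _ => a) (CStarMatrix.ofMatrix.symm M) i j

theorem constDiag_mul_apply {n : ℕ} (M : CStarMatrix (Fin n) (Fin n) A) (a : A) (i j : Fin n) :
    (constDiag A n a * M) i j = a * M i j :=
  Matrix.diagonal_mul (fun _ => a) (CStarMatrix.ofMatrix.symm M) i j

/-- The entries of a scalar matrix are multiples of `1`, hence central in `A`. -/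
theorem constDiag_mul_scalarMatrix {n : ℕ}
    (T : EuclideanSpace ℂ (Fin n) →L[ℂ] EuclideanSpace ℂ (Fin n)) (a : A) :
    constDiag A n a * scalarMatrix A n T = scalarMatrix A n T * constDiag A n a := by
  refine CStarMatrix.ext fun k l => ?_
  rw [constDiag_mul_apply, mul_constDiag_apply, scalarMatrix_apply]
  simp

/-- The compression `T ⊗ a ↦ (⟨ε_k, T ε_l⟩ a)_{k,l}` of `𝒦(ℓ²) ⊙ A` to `M_n(A)`. -/
def tensorCompress (A : Type*) [CStarAlgebra A] (n : ℕ) :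
    compactOperators EllTwo ⊗[ℂ] A →ₗ[ℂ] CStarMatrix (Fin n) (Fin n) A :=
  TensorProduct.lift <| LinearMap.mk₂ ℂ
    (fun T a => CStarMatrix.ofMatrix <| Matrix.of fun k l : Fin n =>
      inner ℂ (stdVec k) ((T : EllTwo →L[ℂ] EllTwo) (stdVec l)) • a)
    (fun S T a => CStarMatrix.ext fun k l => by simp [add_smul])
    (fun c T a => CStarMatrix.ext fun k l => by simp [mul_smul])
    (fun T a b => CStarMatrix.ext fun k l => by simp)
    (fun c T a => CStarMatrix.ext fun k l => smul_comm _ c a)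

theorem tensorCompress_tmul_apply (n : ℕ) (T : compactOperators EllTwo) (a : A) (k l : Fin n) :
    tensorCompress A n (T ⊗ₜ[ℂ] a) k l =
      inner ℂ (stdVec k) ((T : EllTwo →L[ℂ] EllTwo) (stdVec l)) • a := rfl

/-- Writing the compression as a product of values of two ⋆-homomorphisms makes the estimate by `‖T‖
* ‖a‖` immediate, as ⋆-homomorphisms are contractive. -/
theorem tensorCompress_tmul (n : ℕ) (T : compactOperators EllTwo) (a : A) :
    tensorCompress A n (T ⊗ₜ[ℂ] a) =
      scalarMatrix A n (compress n (T : EllTwo →L[ℂ] EllTwo)) * constDiag A n a := by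
  refine CStarMatrix.ext fun k l => ?_
  rw [mul_constDiag_apply, scalarMatrix_apply, compress_apply_single, tensorCompress_tmul_apply,
    smul_mul_assoc, one_mul]

theorem tensorCompress_star (n : ℕ) (x : compactOperators EllTwo ⊗[ℂ] A) :
    tensorCompress A n (star x) = star (tensorCompress A n x) := by
  induction x using TensorProduct.induction_on with
  | zero => rw [star_zero, map_zero, star_zero]
  | add x y hx hy => rw [star_add, map_add, map_add, star_add, hx, hy]
  | tmul T a =>
    refine CStarMatrix.ext fun k l => ?_
    rw [TensorProduct.star_tmul, CStarMatrix.star_apply, tensorCompress_tmul_apply,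
      tensorCompress_tmul_apply, star_smul]
    congr 1
    change inner ℂ _ (star (T : EllTwo →L[ℂ] EllTwo) _) = conj _
    rw [ContinuousLinearMap.star_eq_adjoint, ContinuousLinearMap.adjoint_inner_right,
      inner_conj_symm]

theorem tensorCompress_tmul_mul (n : ℕ) (S T : compactOperators EllTwo) (a b : A) :
    tensorCompress A n (T ⊗ₜ[ℂ] a) * tensorCompress A n (S ⊗ₜ[ℂ] b) =
      scalarMatrix A n (compress n ((T : EllTwo →L[ℂ] EllTwo) ∘L stdProj n ∘L
        (S : EllTwo →L[ℂ] EllTwo))) * constDiag A n (a * b) := by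
  rw [tensorCompress_tmul, tensorCompress_tmul, mul_assoc, ← mul_assoc (constDiag A n a),
    constDiag_mul_scalarMatrix, mul_assoc, ← map_mul, ← mul_assoc, ← map_mul,
    compress_mul_compress]

/-- The failure of compression to be multiplicative. -/
def compressDefect (n : ℕ) (x y : compactOperators EllTwo ⊗[ℂ] A) :
    CStarMatrix (Fin n) (Fin n) A :=
  tensorCompress A n (x * y) - tensorCompress A n x * tensorCompress A n y

theorem compressDefect_add_left (n : ℕ) (x y z : compactOperators EllTwo ⊗[ℂ] A) :
    compressDefect n (x + y) z = compressDefect n x z + compressDefect n y z := by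
  rw [compressDefect, add_mul x y z, map_add, map_add, CStarMatrix.add_mul]
  exact add_sub_add_comm _ _ _ _

theorem compressDefect_add_right (n : ℕ) (x y z : compactOperators EllTwo ⊗[ℂ] A) :
    compressDefect n x (y + z) = compressDefect n x y + compressDefect n x z := by
  rw [compressDefect, mul_add x y z, map_add, map_add, CStarMatrix.mul_add]
  exact add_sub_add_comm _ _ _ _

theorem compressDefect_zero_left (n : ℕ) (x : compactOperators EllTwo ⊗[ℂ] A) :
    compressDefect n 0 x = 0 := by
  simpa using compressDefect_add_left n 0 0 x

theorem compressDefect_zero_right (n : ℕ) (x : compactOperators EllTwo ⊗[ℂ] A) :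
    compressDefect n x 0 = 0 := by
  simpa using compressDefect_add_right n x 0 0

variable [PartialOrder A] [StarOrderedRing A]

theorem norm_tensorCompress_tmul_le (n : ℕ) (T : compactOperators EllTwo) (a : A) :
    ‖tensorCompress A n (T ⊗ₜ[ℂ] a)‖ ≤ ‖T‖ * ‖a‖ := by
  rw [tensorCompress_tmul]
  refine (norm_mul_le _ _).trans (mul_le_mul ?_ (NonUnitalStarAlgHom.norm_apply_le _ _)
    (norm_nonneg _) (norm_nonneg _))
  exact (NonUnitalStarAlgHom.norm_apply_le _ _).trans (norm_compress_le n _)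

theorem tensorCompress_bdd (x : compactOperators EllTwo ⊗[ℂ] A) :
    ∃ C, ∀ n, ‖tensorCompress A n x‖ ≤ C := by
  induction x using TensorProduct.induction_on with
  | zero => exact ⟨0, fun n => by rw [map_zero, norm_zero]⟩
  | tmul T a => exact ⟨_, fun n => norm_tensorCompress_tmul_le n T a⟩
  | add x y hx hy =>
    obtain ⟨C, hC⟩ := hx
    obtain ⟨D, hD⟩ := hy
    exact ⟨C + D, fun n => by
      rw [map_add]
      exact (norm_add_le _ _).trans (add_le_add (hC n) (hD n))⟩

/-- The defect is the compression of `T S - T P S = -(T P - T) S`, tensored with `a b`, where `P` is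
the projection `stdProj n`. -/
theorem norm_compressDefect_tmul_le (n : ℕ) (S T : compactOperators EllTwo) (a b : A) :
    ‖compressDefect n (T ⊗ₜ[ℂ] a) (S ⊗ₜ[ℂ] b)‖ ≤
      ‖(T : EllTwo →L[ℂ] EllTwo) ∘L stdProj n - (T : EllTwo →L[ℂ] EllTwo)‖ * ‖S‖ * ‖a * b‖ := by
  rw [compressDefect, tensorCompress_tmul_mul, Algebra.TensorProduct.tmul_mul_tmul, tensorCompress_tmul,
    ← sub_mul, ← map_sub, ← compress_sub]
  refine (norm_mul_le _ _).trans (mul_le_mul ?_ (NonUnitalStarAlgHom.norm_apply_le _ _)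
    (norm_nonneg _) (mul_nonneg (norm_nonneg _) (norm_nonneg _)))
  refine (NonUnitalStarAlgHom.norm_apply_le _ _).trans ((norm_compress_le n _).trans ?_)
  have e : ((T * S : compactOperators EllTwo) : EllTwo →L[ℂ] EllTwo) -
      (T : EllTwo →L[ℂ] EllTwo) ∘L stdProj n ∘L (S : EllTwo →L[ℂ] EllTwo) =
      -(((T : EllTwo →L[ℂ] EllTwo) ∘L stdProj n - (T : EllTwo →L[ℂ] EllTwo)) ∘L (S : EllTwo →L[ℂ] EllTwo)) := by
    rw [ContinuousLinearMap.sub_comp, neg_sub]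
    rfl
  rw [e, norm_neg]
  exact ContinuousLinearMap.opNorm_comp_le _ _

/-- Compressions are asymptotically multiplicative, since truncations of a compact operator
converge in norm. -/
theorem tendsto_compressDefect (x y : compactOperators EllTwo ⊗[ℂ] A) :
    Tendsto (fun n => ‖compressDefect n x y‖) atTop (𝓝 0) := by
  have hadd : ∀ {f g h : ℕ → ℝ}, Tendsto f atTop (𝓝 0) → Tendsto g atTop (𝓝 0) →
      (∀ n, 0 ≤ h n) → (∀ n, h n ≤ f n + g n) → Tendsto h atTop (𝓝 0) := fun hf hg h0 h1 =>
    squeeze_zero h0 h1 (by simpa using hf.add hg)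
  induction x using TensorProduct.induction_on with
  | zero => simp only [compressDefect_zero_left, norm_zero, tendsto_const_nhds]
  | add x₁ x₂ h₁ h₂ =>
    refine hadd h₁ h₂ (fun _ => norm_nonneg _) fun n => ?_
    rw [compressDefect_add_left]
    exact norm_add_le _ _
  | tmul T a =>
    induction y using TensorProduct.induction_on with
    | zero => simp only [compressDefect_zero_right, norm_zero, tendsto_const_nhds]
    | add y₁ y₂ h₁ h₂ =>
      refine hadd h₁ h₂ (fun _ => norm_nonneg _) fun n => ?_
      rw [compressDefect_add_right]
      exact norm_add_le _ _
    | tmul S b =>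
      have h := ((tendsto_iff_norm_sub_tendsto_zero.1 (tendsto_comp_stdProj T.2)).mul_const
        ‖S‖).mul_const ‖a * b‖
      rw [zero_mul, zero_mul] at h
      exact squeeze_zero (fun _ => norm_nonneg _)
        (fun n => norm_compressDefect_tmul_le n S T a b) h

/-- A bounded sequence converges along every ultrafilter, so boundedness alone yields a limit. The
chosen ultrafilter is finer than `atTop`, so ordinary limits, in particular that of the defect,
persist along it. -/
theorem exists_tendsto_norm_tensorCompress (x : compactOperators EllTwo ⊗[ℂ] A) :
    ∃ r : ℝ, Tendsto (fun n => ‖tensorCompress A n x‖) (hyperfilter ℕ : Filter ℕ) (𝓝 r) := by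
  obtain ⟨C, hC⟩ := tensorCompress_bdd x
  have h := (isCompact_Icc (a := (0 : ℝ)) (b := C)).ultrafilter_le_nhds
    ((hyperfilter ℕ).map fun n => ‖tensorCompress A n x‖)
    (le_principal_iff.2 (Ultrafilter.mem_map.2 (Filter.Eventually.of_forall fun n =>
      ⟨norm_nonneg (tensorCompress A n x), hC n⟩)))
  obtain ⟨r, -, hr⟩ := h
  exact ⟨r, hr⟩

/-- The limit of the norms of compressions along an ultrafilter. -/
def stabNorm (x : compactOperators EllTwo ⊗[ℂ] A) : ℝ :=
  limUnder (hyperfilter ℕ : Filter ℕ) fun n => ‖tensorCompress A n x‖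

theorem tendsto_stabNorm (x : compactOperators EllTwo ⊗[ℂ] A) :
    Tendsto (fun n => ‖tensorCompress A n x‖) (hyperfilter ℕ : Filter ℕ) (𝓝 (stabNorm x)) :=
  tendsto_nhds_limUnder (exists_tendsto_norm_tensorCompress x)

theorem hyperfilter_le_atTop : (hyperfilter ℕ : Filter ℕ) ≤ atTop :=
  Nat.hyperfilter_le_atTop

/-- The limit of the norms of compressions, as a C⋆-seminorm. -/
def stabSeminorm (A : Type*) [CStarAlgebra A] [PartialOrder A] [StarOrderedRing A] :
    CStarSeminorm (compactOperators EllTwo ⊗[ℂ] A) where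
  toFun := stabNorm
  map_zero' := tendsto_nhds_unique (tendsto_stabNorm 0) (by simp)
  add_le' x y := le_of_tendsto_of_tendsto' (tendsto_stabNorm (x + y))
    ((tendsto_stabNorm x).add (tendsto_stabNorm y)) fun n => by
      rw [map_add]; exact norm_add_le _ _
  neg' x := tendsto_nhds_unique (tendsto_stabNorm (-x)) (by simpa using tendsto_stabNorm x)
  smul' c x := tendsto_nhds_unique (tendsto_stabNorm (c • x))
    (by simpa [norm_smul] using (tendsto_stabNorm x).const_mul ‖c‖)
  mul_le' x y := by
    have h := ((tendsto_compressDefect x y).mono_left hyperfilter_le_atTop).add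
      ((tendsto_stabNorm x).mul (tendsto_stabNorm y))
    rw [zero_add] at h
    refine le_of_tendsto_of_tendsto' (tendsto_stabNorm (x * y)) h fun n => ?_
    calc ‖tensorCompress A n (x * y)‖
        = ‖compressDefect n x y + tensorCompress A n x * tensorCompress A n y‖ := by
          rw [compressDefect, sub_add_cancel]
      _ ≤ _ := (norm_add_le _ _).trans (add_le_add_right (norm_mul_le _ _) _)
  star_mul_self' x := by
    have h0 := (tendsto_compressDefect (star x) x).mono_left hyperfilter_le_atTop
    have h1 := (tendsto_stabNorm (star x * x)).sub ((tendsto_stabNorm x).mul (tendsto_stabNorm x))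
    -- By the C⋆-identity in `M_n(A)` this difference is bounded by the norm of the defect of `star
    -- x` and `x`.
    have h2 : Tendsto (fun n => ‖tensorCompress A n (star x * x)‖ -
        ‖tensorCompress A n x‖ * ‖tensorCompress A n x‖) (hyperfilter ℕ : Filter ℕ) (𝓝 0) := by
      refine squeeze_zero_norm (fun n => ?_) h0
      rw [compressDefect, tensorCompress_star, ← CStarRing.norm_star_mul_self]
      exact abs_norm_sub_norm_le _ _
    exact sub_eq_zero.1 (tendsto_nhds_unique h1 h2)

theorem stabSeminorm_mem : stabSeminorm A ∈ tensorSeminorms (compactOperators EllTwo) A :=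
  fun T a => le_of_tendsto' (tendsto_stabNorm (T ⊗ₜ[ℂ] a)) fun n =>
    norm_tensorCompress_tmul_le n T a

theorem le_maxTensorSeminorm {B C : Type*} [NonUnitalCStarAlgebra B] [NonUnitalCStarAlgebra C]
    {p : CStarSeminorm (B ⊗[ℂ] C)} (hp : p ∈ tensorSeminorms B C) (x : B ⊗[ℂ] C) :
    p x ≤ maxTensorSeminorm B C x := by
  obtain ⟨D, hD⟩ := tensorSeminorms_bdd B C x
  exact le_ciSup (f := fun p : tensorSeminorms B C => p.1 x)
    ⟨D, by rintro _ ⟨q, rfl⟩; exact hD q.1 q.2⟩ ⟨p, hp⟩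

/-- An entry of a matrix is bounded by its norm. If the entry is the same in all large compressions,
the bound survives in the limit seminorm, which the largest seminorm dominates. -/
theorem norm_entry_le_maxTensorSeminorm (x : compactOperators EllTwo ⊗[ℂ] A) (k l : ℕ) (a : A)
    (h : ∀ n (hk : k < n) (hl : l < n), tensorCompress A n x ⟨k, hk⟩ ⟨l, hl⟩ = a) :
    ‖a‖ ≤ maxTensorSeminorm (compactOperators EllTwo) A x := by
  refine le_trans ?_ (le_maxTensorSeminorm (stabSeminorm_mem (A := A)) x)
  refine ge_of_tendsto (tendsto_stabNorm x) (Filter.Eventually.filter_mono hyperfilter_le_atTop ?_)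
  filter_upwards [eventually_gt_atTop k, eventually_gt_atTop l] with n hk hl
  rw [← h n hk hl]
  exact CStarMatrix.norm_entry_le_norm

end compression

/-! ### Elementary tensors -/

namespace CStarTensor
variable {A B : Type*} [NonUnitalCStarAlgebra A] [NonUnitalCStarAlgebra B]

theorem tmul_add (a : A) (b c : B) : tmul a (b + c) = tmul a b + tmul a c := by
  rw [tmul, TensorProduct.tmul_add]
  exact CStarSeminorm.toCompletion_add _ _ _

theorem add_tmul (a b : A) (c : B) : tmul (a + b) c = tmul a c + tmul b c := by
  rw [tmul, TensorProduct.add_tmul]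
  exact CStarSeminorm.toCompletion_add _ _ _

theorem tmul_smul (z : ℂ) (a : A) (b : B) : tmul a (z • b) = z • tmul a b := by
  rw [tmul, TensorProduct.tmul_smul]
  exact CStarSeminorm.toCompletion_smul _ _ _

theorem smul_tmul (z : ℂ) (a : A) (b : B) : tmul (z • a) b = z • tmul a b := by
  rw [tmul, ← TensorProduct.smul_tmul']
  exact CStarSeminorm.toCompletion_smul _ _ _

theorem tmul_zero (a : A) : tmul a (0 : B) = 0 := by
  rw [tmul, TensorProduct.tmul_zero]
  exact CStarSeminorm.toCompletion_zero _

theorem zero_tmul (b : B) : tmul (0 : A) b = 0 := by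
  rw [tmul, TensorProduct.zero_tmul]
  exact CStarSeminorm.toCompletion_zero _

theorem tmul_mul_tmul (a b : A) (c d : B) : tmul a c * tmul b d = tmul (a * b) (c * d) :=
  (CStarSeminorm.toCompletion_mul _ _ _).symm.trans
    (congrArg _ (Algebra.TensorProduct.tmul_mul_tmul a b c d))

theorem star_tmul (a : A) (b : B) : star (tmul a b) = tmul (star a) (star b) :=
  (CStarSeminorm.toCompletion_star _ _).symm.trans (congrArg _ (TensorProduct.star_tmul a b))

theorem norm_tmul_le (a : A) (b : B) : ‖tmul a b‖ ≤ ‖a‖ * ‖b‖ := by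
  refine (CStarSeminorm.norm_toCompletion _ _).le.trans ?_
  have : Nonempty (tensorSeminorms A B) := (tensorSeminorms_nonempty A B).to_subtype
  exact ciSup_le fun p : tensorSeminorms A B => p.2 a b

/-- `a ↦ a ⊗ b` as an additive map. -/
def tmulRight (b : B) : A →+ CStarTensor A B where
  toFun a := tmul a b
  map_zero' := zero_tmul b
  map_add' a c := add_tmul a c b

theorem continuous_tmul_left (b : B) : Continuous fun a : A => tmul a b :=
  (AddMonoidHomClass.lipschitz_of_bound (tmulRight (A := A) b) ‖b‖ fun a => by
    rw [mul_comm]; exact norm_tmul_le a b).continuous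

end CStarTensor

/-! ### The corner embedding `M_n(A) → 𝒦(ℓ²) ⊗ A` -/

section corner
variable {A : Type*} [CStarAlgebra A]

/-- `cornerToStabilization` as a ⋆-homomorphism. -/
def cornerHom (A : Type*) [CStarAlgebra A] (n : ℕ) :
    CStarMatrix (Fin n) (Fin n) A →⋆ₙₐ[ℂ] CStarTensor (compactOperators EllTwo) A where
  toFun := cornerToStabilization
  map_smul' c M := by
    simp only [cornerToStabilization, CStarMatrix.smul_apply, CStarTensor.tmul_smul,
      Finset.smul_sum, MonoidHom.id_apply]
  map_zero' := by
    simp only [cornerToStabilization, CStarMatrix.zero_apply, CStarTensor.tmul_zero,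
      Finset.sum_const_zero]
  map_add' M N := by
    simp only [cornerToStabilization, CStarMatrix.add_apply, CStarTensor.tmul_add,
      Finset.sum_add_distrib]
  map_mul' M N := by
    have hsum : ∀ (T : compactOperators EllTwo) (f : Fin n → A),
        CStarTensor.tmul T (∑ j, f j) = ∑ j, CStarTensor.tmul T (f j) := fun T f =>
      map_sum (AddMonoidHom.mk' (fun a : A => CStarTensor.tmul T a) (CStarTensor.tmul_add T)) f _
    -- The relation `e_{k,l} e_{p,q} = δ_{l,p} e_{k,q}` collapses one of the four summations; the
    -- remaining three only have to be reordered.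
    have hdelta : ∀ p q k : Fin n, ∑ l : Fin n, CStarTensor.tmul
        (if (l : ℕ) = p then matrixUnit k q else 0) (M k l * N p q) =
        CStarTensor.tmul (matrixUnit k q) (M k p * N p q) := fun p q k => by
      rw [Finset.sum_eq_single p, if_pos rfl]
      · intro l _ hl
        rw [if_neg fun h => hl (Fin.ext h), CStarTensor.zero_tmul]
      · exact fun h => (h (Finset.mem_univ p)).elim
    simp only [cornerToStabilization, CStarMatrix.mul_apply, hsum, Finset.sum_mul, Finset.mul_sum,
      CStarTensor.tmul_mul_tmul, matrixUnit_mul, hdelta]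
    rw [Finset.sum_comm]
    conv_rhs => rw [Finset.sum_comm]
    refine Finset.sum_congr rfl fun q _ => ?_
    exact Finset.sum_comm
  map_star' M := by
    simp only [cornerToStabilization, star_sum, CStarTensor.star_tmul, star_matrixUnit,
      CStarMatrix.star_apply]
    exact Finset.sum_comm

/-- This lower bound rules out any collapse of the corner in the completion; injectivity of the
corner maps rests on it. -/
theorem norm_entry_le_norm_cornerToStabilization {n : ℕ} (M : CStarMatrix (Fin n) (Fin n) A)
    (k l : Fin n) : ‖M k l‖ ≤ ‖cornerToStabilization M‖ := by
  -- The norm on matrices over `A` refers to an order on `A`. The claim does not, so the spectral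
  -- order may be chosen.
  let _ : PartialOrder A := CStarAlgebra.spectralOrder A
  have _ : StarOrderedRing A := CStarAlgebra.spectralOrderedRing A
  let x : compactOperators EllTwo ⊗[ℂ] A := ∑ p : Fin n, ∑ q : Fin n, matrixUnit p q ⊗ₜ[ℂ] M p q
  let f : compactOperators EllTwo ⊗[ℂ] A →+ CStarTensor (compactOperators EllTwo) A :=
    AddMonoidHom.mk' (maxTensorSeminorm (compactOperators EllTwo) A).toCompletion
      (CStarSeminorm.toCompletion_add _)
  have hx : f x = cornerToStabilization M := by
    simp only [x, map_sum]
    rfl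
  have hn : ‖f x‖ = maxTensorSeminorm (compactOperators EllTwo) A x :=
    CStarSeminorm.norm_toCompletion _ _
  rw [← hx, hn]
  refine norm_entry_le_maxTensorSeminorm x k l (M k l) fun m hk hl => ?_
  let g : compactOperators EllTwo ⊗[ℂ] A →+ A :=
    AddMonoidHom.mk' (fun y => tensorCompress A m y ⟨k, hk⟩ ⟨l, hl⟩) fun y z => by
      rw [map_add, CStarMatrix.add_apply]
  have hg : ∀ p q : Fin n, g (matrixUnit p q ⊗ₜ[ℂ] M p q) =
      if k = p ∧ l = q then M p q else 0 := fun p q => by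
    change tensorCompress A m (matrixUnit p q ⊗ₜ[ℂ] M p q) ⟨k, hk⟩ ⟨l, hl⟩ = _
    rw [tensorCompress_tmul_apply, matrixUnit_apply, inner_smul_right, inner_stdVec_stdVec,
      stdVec_apply]
    simp only [← Fin.ext_iff, eq_comm (a := q)]
    split_ifs <;> simp_all
  change g x = M k l
  simp only [x, map_sum, hg, ite_and]
  simp

theorem cornerHom_injective (A : Type*) [CStarAlgebra A] (n : ℕ) :
    Function.Injective (cornerHom A n) := by
  rw [injective_iff_map_eq_zero]
  intro M hM
  refine CStarMatrix.ext fun k l => norm_le_zero_iff.1 ?_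
  rw [← norm_zero (E := CStarTensor (compactOperators EllTwo) A), ← hM]
  exact norm_entry_le_norm_cornerToStabilization M k l

/-- The additional rows and columns are zero and contribute nothing. This is the compatibility of
the corner maps with the connecting maps. -/
theorem cornerToStabilization_cornerEmbedding {i : ℕ}
    (M : CStarMatrix (Fin (2 ^ i)) (Fin (2 ^ i)) A) :
    cornerToStabilization (cornerEmbedding M) = cornerToStabilization M := by
  have hle : 2 ^ i ≤ 2 ^ (i + 1) := Nat.pow_le_pow_right two_pos i.le_succ
  have hnr : ∀ k : Fin (2 ^ (i + 1)), k ∉ Set.range (Fin.castLE hle) → ¬ (k : ℕ) < 2 ^ i :=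
    fun k hk h => hk ⟨⟨k, h⟩, rfl⟩
  refine (Fintype.sum_of_injective (Fin.castLE hle) (Fin.castLE_injective hle) _ _
    (fun k hk => ?_) fun k => ?_).symm
  · refine Finset.sum_eq_zero fun l _ => ?_
    rw [cornerEmbedding_apply, dif_neg fun h => hnr k hk h.1, CStarTensor.tmul_zero]
  · refine Fintype.sum_of_injective (Fin.castLE hle) (Fin.castLE_injective hle) _ _
      (fun l hl => ?_) fun l => ?_
    · rw [cornerEmbedding_apply, dif_neg fun h => hnr l hl h.2, CStarTensor.tmul_zero]
    · rw [cornerEmbedding_apply, dif_pos ⟨k.2, l.2⟩]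
      rfl

theorem exists_cornerToStabilization_eq_tmul (k l : ℕ) (a : A) :
    ∃ (i : ℕ) (M : CStarMatrix (Fin (2 ^ i)) (Fin (2 ^ i)) A),
      cornerToStabilization M = CStarTensor.tmul (matrixUnit k l) a := by
  -- The exponent `k + l` is a convenient choice for which `2 ^ (k + l)` exceeds both indices.
  have hk : k < 2 ^ (k + l) := (Nat.lt_two_pow_self).trans_le
    (Nat.pow_le_pow_right two_pos (Nat.le_add_right k l))
  have hl : l < 2 ^ (k + l) := (Nat.lt_two_pow_self).trans_le
    (Nat.pow_le_pow_right two_pos (Nat.le_add_left l k))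
  refine ⟨k + l, CStarMatrix.ofMatrix (Matrix.single ⟨k, hk⟩ ⟨l, hl⟩ a), ?_⟩
  rw [cornerToStabilization, Finset.sum_eq_single ⟨k, hk⟩, Finset.sum_eq_single ⟨l, hl⟩]
  · simp
  · intro q _ hq
    rw [CStarMatrix.ofMatrix_apply, Matrix.single_apply_of_ne _ _ _ _ _ (by simp [hq.symm]),
      CStarTensor.tmul_zero]
  · simp
  · intro p _ hp
    refine Finset.sum_eq_zero fun q _ => ?_
    rw [CStarMatrix.ofMatrix_apply, Matrix.single_apply_of_ne _ _ _ _ _ (by simp [hp.symm]),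
      CStarTensor.tmul_zero]
  · simp

/-- A closed subspace of `𝒦(ℓ²) ⊗ A` that contains all corners `M_{2^i}(A)` is everything. -/
theorem eq_top_of_cornerToStabilization_mem
    (S : AddSubgroup (CStarTensor (compactOperators EllTwo) A)) (hS : IsClosed (S : Set (CStarTensor (compactOperators EllTwo) A)))
    (h : ∀ (i : ℕ) (M : CStarMatrix (Fin (2 ^ i)) (Fin (2 ^ i)) A), cornerToStabilization M ∈ S) :
    S = ⊤ := by
  have htmul : ∀ (T : compactOperators EllTwo) (a : A), CStarTensor.tmul T a ∈ S := fun T a => by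
    -- Truncations of `T` are finite combinations of matrix units, whose tensors with `a` lie in
    -- corners. Closedness of `S` then yields the limit.
    let P : ℕ → compactOperators EllTwo := fun n => ∑ k : Fin n, ∑ l : Fin n,
      inner ℂ (stdVec k) ((T : EllTwo →L[ℂ] EllTwo) (stdVec l)) • matrixUnit k l
    have hP : Tendsto P atTop (𝓝 T) := by
      rw [tendsto_subtype_rng]
      refine (tendsto_stdProj_comp_stdProj T.2).congr fun n => ?_
      rw [stdProj_comp_comp_stdProj]
      simp [P]
    refine hS.mem_of_tendsto (((CStarTensor.continuous_tmul_left a).tendsto T).comp hP)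
      (Filter.Eventually.of_forall fun n => ?_)
    change CStarTensor.tmulRight a (P n) ∈ S
    rw [map_sum]
    refine sum_mem fun k _ => ?_
    rw [map_sum]
    refine sum_mem fun l _ => ?_
    change CStarTensor.tmul (_ • _) a ∈ S
    -- `S` is only an additive subgroup, so the scalar is absorbed into the factor in `A`.
    rw [CStarTensor.smul_tmul, ← CStarTensor.tmul_smul]
    obtain ⟨i, M, hM⟩ := exists_cornerToStabilization_eq_tmul k l
      (inner ℂ (stdVec k) ((T : EllTwo →L[ℂ] EllTwo) (stdVec l)) • a)
    rw [← hM]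
    exact h i M
  refine eq_top_iff.2 fun x _ => ?_
  refine (maxTensorSeminorm (compactOperators EllTwo) A).completion_induction x hS fun t => ?_
  induction t using TensorProduct.induction_on with
  | zero => exact S.zero_mem
  | tmul T a => exact htmul T a
  | add y z hy hz =>
    rw [CStarSeminorm.toCompletion_add]
    exact S.add_mem hy hz

end corner

/-! ### The universal property of the stationary limit -/

namespace StationaryLimit
variable {A B : Type*} [NonUnitalCStarAlgebra A] [NonUnitalCStarAlgebra B] (φ : A →⋆ₙₐ[ℂ] A)

/-- From some place `N` on, a thread coincides with the one started at its own `N`-th term, and the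
limit of norms ignores the terms before. The images of the maps `ι φ n` therefore exhaust the dense
subalgebra of threads. -/
theorem exists_ι_eq (x : Threads φ) :
    ∃ n, (seminorm φ).toCompletion x = ι φ n (x.1 n) := by
  obtain ⟨N, hN⟩ := eventually_atTop.1 x.2
  refine ⟨N, ?_⟩
  have hx : ∀ k, x.1 (N + k) = φ^[k] (x.1 N) := fun k => by
    induction k with
    | zero => rfl
    | succ k ih =>
      rw [← add_assoc, hN _ (Nat.le_add_right N k), ih, Function.iterate_succ_apply']
  change _ = (seminorm φ).toCompletion (thread φ N (x.1 N))
  rw [← sub_eq_zero, ← CStarSeminorm.toCompletion_sub]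
  refine CStarSeminorm.toCompletion_eq_zero _ (tendsto_nhds_unique
    (tendsto_limNorm φ (x - thread φ N (x.1 N))) ?_)
  refine tendsto_const_nhds.congr' ((eventually_ge_atTop N).mono fun k hk => ?_)
  obtain ⟨k, rfl⟩ := Nat.exists_eq_add_of_le hk
  change 0 = ‖x.1 (N + k) - (thread φ N (x.1 N)).1 (N + k)‖
  rw [thread_apply, if_pos hk, Nat.add_sub_cancel_left, hx, sub_self, norm_zero]

@[elab_as_elim]
theorem induction_ι {P : StationaryLimit φ → Prop} (x : StationaryLimit φ)
    (hc : IsClosed {a | P a}) (h : ∀ n a, P (ι φ n a)) : P x :=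
  (seminorm φ).completion_induction x hc fun t => by
    obtain ⟨n, hn⟩ := exists_ι_eq φ t
    rw [hn]
    exact h n _

variable {φ}

/-- A compatible family of ⋆-homomorphisms extends to the stationary limit. -/
theorem exists_lift (j : ℕ → A →⋆ₙₐ[ℂ] B) (hj : ∀ n a, j (n + 1) (φ a) = j n a) :
    ∃ Ψ : StationaryLimit φ →⋆ₙₐ[ℂ] B, ∀ n a, Ψ (ι φ n a) = j n a := by
  -- Compatibility of the family makes `j n (x n)` eventually constant along a thread; the eventual
  -- value defines the map on threads.
  have hex : ∀ x : Threads φ, ∃ b : B, ∀ᶠ n in atTop, j n (x.1 n) = b := fun x => by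
    obtain ⟨N, hN⟩ := eventually_atTop.1 x.2
    refine ⟨j N (x.1 N), eventually_atTop.2 ⟨N, fun n hn => ?_⟩⟩
    induction n, hn using Nat.le_induction with
    | base => rfl
    | succ n hn ih => rw [hN n hn, hj, ih]
  choose f hf using hex
  have hfu : ∀ (x : Threads φ) (b : B), (∀ᶠ n in atTop, j n (x.1 n) = b) → f x = b :=
    fun x b hb => by
      obtain ⟨n, h1, h2⟩ := ((hf x).and hb).exists
      rw [← h1, h2]
  let F : Threads φ →⋆ₙₐ[ℂ] B :=
    { toFun := f
      map_smul' := fun c x => hfu _ _ ((hf x).mono fun n h => by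
        change j n (c • x.1 n) = _
        rw [map_smul, h]; rfl)
      map_zero' := hfu _ _ (Filter.Eventually.of_forall fun n => map_zero (j n))
      map_add' := fun x y => hfu _ _ (((hf x).and (hf y)).mono fun n h => by
        change j n (x.1 n + y.1 n) = _
        rw [map_add, h.1, h.2])
      map_mul' := fun x y => hfu _ _ (((hf x).and (hf y)).mono fun n h => by
        change j n (x.1 n * y.1 n) = _
        rw [map_mul, h.1, h.2])
      map_star' := fun x => hfu _ _ ((hf x).mono fun n h => by
        change j n (star (x.1 n)) = _
        rw [map_star, h]) }
  have hF : ∀ x, ‖F x‖ ≤ seminorm φ x := fun x =>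
    ge_of_tendsto (tendsto_limNorm φ x) ((hf x).mono fun n h => by
      change ‖f x‖ ≤ _
      rw [← h]
      exact NonUnitalStarAlgHom.norm_apply_le (j n) _)
  obtain ⟨Ψ, -, hΨ⟩ := (seminorm φ).exists_extension F hF
  refine ⟨Ψ, fun n a => (hΨ _).trans (hfu _ _ (eventually_atTop.2 ⟨n, fun k hk => ?_⟩))⟩
  obtain ⟨k, rfl⟩ := Nat.exists_eq_add_of_le hk
  rw [thread_apply, if_pos hk, Nat.add_sub_cancel_left]
  clear hk
  induction k with
  | zero => rfl
  | succ k ih => rw [Function.iterate_succ_apply', ← add_assoc, hj, ih]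

theorem continuous_starHom {C D : Type*} [NonUnitalCStarAlgebra C] [NonUnitalCStarAlgebra D]
    (f : C →⋆ₙₐ[ℂ] D) : Continuous f :=
  (AddMonoidHomClass.lipschitz_of_bound f 1 fun x => by
    rw [one_mul]; exact NonUnitalStarAlgHom.norm_apply_le f x).continuous

/-- If all the maps out of the copies of `A` are injective, so is the induced map on the limit. -/
theorem isometry_of_injective (Ψ : StationaryLimit φ →⋆ₙₐ[ℂ] B)
    (h : ∀ n, Function.Injective fun a => Ψ (ι φ n a)) : Isometry Ψ := by
  refine AddMonoidHomClass.isometry_of_norm Ψ fun x => ?_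
  refine induction_ι φ x (isClosed_eq (continuous_starHom Ψ).norm continuous_norm) fun n a => ?_
  refine le_antisymm (NonUnitalStarAlgHom.norm_apply_le Ψ _) ?_
  -- An injective ⋆-homomorphism of C⋆-algebras is isometric. Together with contractivity of `ι φ n`
  -- this gives the missing inequality, without assuming that `ι φ n` is injective.
  have hi : ‖(Ψ.comp (ι φ n)) a‖ = ‖a‖ := NonUnitalStarAlgHom.norm_map (Ψ.comp (ι φ n)) (h n) a
  exact (NonUnitalStarAlgHom.norm_apply_le (ι φ n) a).trans hi.ge

end StationaryLimit

/-- The maps `Θ i` turn the connecting map `φ` into the corner embedding, so the limit is that of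
the matrix algebras `M_{2^i}(A)`. No other property of `φ` or `A` enters, and uniqueness holds since
the images of the copies of `A` are dense. -/
theorem existsUnique_stabilization_equiv {A : Type*} [CStarAlgebra A] (φ : A →⋆ₙₐ[ℂ] A)
    (Θ : ∀ i : ℕ, A ≃⋆ₐ[ℂ] CStarMatrix (Fin (2 ^ i)) (Fin (2 ^ i)) A)
    (hΘ : ∀ i x, Θ (i + 1) (φ x) = cornerEmbedding (Θ i x)) :
    ∃! Φ : StationaryLimit φ ≃⋆ₐ[ℂ] CStarTensor (compactOperators EllTwo) A,
      ∀ i x, Φ (StationaryLimit.ι φ i x) = cornerToStabilization (Θ i x) := by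
  let j : ℕ → A →⋆ₙₐ[ℂ] CStarTensor (compactOperators EllTwo) A := fun i =>
    (cornerHom A (2 ^ i)).comp (Θ i : A →⋆ₙₐ[ℂ] CStarMatrix (Fin (2 ^ i)) (Fin (2 ^ i)) A)
  have hj : ∀ i x, j i x = cornerToStabilization (Θ i x) := fun i x => rfl
  obtain ⟨Ψ, hΨ⟩ := StationaryLimit.exists_lift (φ := φ) j fun n a => by
    rw [hj, hj, hΘ, cornerToStabilization_cornerEmbedding]
  have hiso : Isometry Ψ := StationaryLimit.isometry_of_injective Ψ fun n a b hab => by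
    simp only [hΨ] at hab
    exact EquivLike.injective (Θ n) (cornerHom_injective A _ hab)
  have hsurj : Function.Surjective Ψ := by
    -- An isometry from a complete space has closed range, and surjectivity of each `Θ i` puts every
    -- corner into that range.
    have hcl : IsClosed (Set.range Ψ) := hiso.isClosedEmbedding.isClosed_range
    have htop := eq_top_of_cornerToStabilization_mem 
      (AddMonoidHom.range (AddMonoidHomClass.toAddMonoidHom Ψ)) hcl
      fun i M => by
        obtain ⟨x, rfl⟩ := EquivLike.surjective (Θ i) M
        exact ⟨StationaryLimit.ι φ i x, hΨ i x⟩
    exact AddMonoidHom.range_eq_top.1 htop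
  refine ⟨StarAlgEquiv.ofBijective Ψ ⟨hiso.injective, hsurj⟩, hΨ, fun Φ hΦ => ?_⟩
  refine StarAlgEquiv.ext fun x => ?_
  have hc : Continuous Φ := StationaryLimit.continuous_starHom
    (Φ : StationaryLimit φ →⋆ₙₐ[ℂ] CStarTensor (compactOperators EllTwo) A)
  refine StationaryLimit.induction_ι φ x (isClosed_eq hc hiso.continuous) fun n a => ?_
  exact (hΦ n a).trans (hΨ n a).symm

theorem Q2Relations.map {A B : Type*} [Ring A] [StarRing A] [Algebra ℂ A] [Ring B] [StarRing B]
    [Algebra ℂ B] {u s : A} (h : Q2Relations u s) (f : A ≃⋆ₐ[ℂ] B) : Q2Relations (f u) (f s) where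
  star_mul_u := by rw [← map_star, ← map_mul, h.star_mul_u, map_one]
  u_mul_star := by rw [← map_star, ← map_mul, h.u_mul_star, map_one]
  star_mul_s := by rw [← map_star, ← map_mul, h.star_mul_s, map_one]
  s_mul_u := by rw [← map_pow, ← map_mul, ← map_mul, h.s_mul_u]
  range_sum := by
    simp only [← map_star, ← map_mul, ← map_add]
    rw [h.range_sum, map_one]

end

theorem proposition6p3 :
    ∃ θ : Q2Alg ≃⋆ₐ[ℂ] CStarMatrix (Fin 2) (Fin 2) Q2Alg,
      (θ Q2Alg.u = CStarMatrix.ofMatrix !![0, Q2Alg.u; 1, 0] ∧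
        θ Q2Alg.s = CStarMatrix.ofMatrix !![Q2Alg.s, Q2Alg.u * Q2Alg.s; 0, 0]) ∧
      (∀ θ' : Q2Alg →⋆ₐ[ℂ] CStarMatrix (Fin 2) (Fin 2) Q2Alg,
        θ' Q2Alg.u = CStarMatrix.ofMatrix !![0, Q2Alg.u; 1, 0] →
        θ' Q2Alg.s = CStarMatrix.ofMatrix !![Q2Alg.s, Q2Alg.u * Q2Alg.s; 0, 0] →
        ∀ x, θ' x = θ x) ∧
      ∃ Θ : ∀ i : ℕ, Q2Alg ≃⋆ₐ[ℂ] CStarMatrix (Fin (2 ^ i)) (Fin (2 ^ i)) Q2Alg,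
        (∀ x k l, Θ 0 x k l = x) ∧
        (∀ i x, Θ (i + 1) x = applyEntrywise θ (Θ i x)) ∧
        (∀ i x, Θ (i + 1) (Q2Alg.Ad x) = cornerEmbedding (Θ i x)) ∧
        ∃! Φ : StationaryLimit Q2Alg.Ad ≃⋆ₐ[ℂ] CStarTensor (compactOperators EllTwo) Q2Alg,
          ∀ i x, Φ (StationaryLimit.ι Q2Alg.Ad i x) = cornerToStabilization (Θ i x) := by
  have hr := Q2Alg.relations
  let θ : Q2Alg ≃⋆ₐ[ℂ] CStarMatrix (Fin 2) (Fin 2) Q2Alg := hr.isCuntzFamily.matrixEquiv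
  have hcorner := iterMatrixEquiv_succ_eq_cornerEmbedding θ Q2Alg.Ad hr.matrixEquiv_conj
  refine ⟨θ, ⟨hr.matrixEquiv_u, hr.matrixEquiv_s⟩, fun θ' hu hs x => ?_, iterMatrixEquiv θ,
    iterMatrixEquiv_zero_apply θ, iterMatrixEquiv_succ_apply θ, hcorner,
    existsUnique_stabilization_equiv Q2Alg.Ad (iterMatrixEquiv θ) hcorner⟩
  -- Uniqueness of `ϑ_{1,2}` uses the universal property with target `M₂(𝒬₂)`, which becomes a
  -- C⋆-algebra once an order on `𝒬₂` is fixed.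
  let _ : PartialOrder Q2Alg := CStarAlgebra.spectralOrder Q2Alg
  have _ : StarOrderedRing Q2Alg := CStarAlgebra.spectralOrderedRing Q2Alg
  -- The relations for the two matrices are carried over by the isomorphism already constructed,
  -- which avoids computing with matrices.
  have hrel : Q2Relations (θ Q2Alg.u) (θ Q2Alg.s) := hr.map θ
  let θh : Q2Alg →⋆ₐ[ℂ] CStarMatrix (Fin 2) (Fin 2) Q2Alg := (θ : Q2Alg →⋆ₐ[ℂ] _)
  have h := (Q2Alg.existsUnique_hom (θ Q2Alg.u) (θ Q2Alg.s) hrel).unique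
    (y₁ := θ') (y₂ := θh) ⟨hu.trans hr.matrixEquiv_u.symm, hs.trans hr.matrixEquiv_s.symm⟩
    ⟨rfl, rfl⟩
  exact DFunLike.congr_fun h x
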